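/- **Asymptotic distribution of the least-squares weights.** Write $\operatorname{vec}$ for the stacking of columns and $\otimes$ for the Kronecker product. Fix $L,H\in\mathbb N$. (a) For every $N$ let $\mathbf X=\mathbf X_N\in\mathbb R^{N\times L}$ and $\mathbf Y=\mathbf Y_N\in\mathbb R^{N\times H}$ be random matrices with $$\begin{pmatrix}\operatorname{vec}\mathbf X\\ \operatorname{vec}\mathbf Y\end{pmatrix}\sim\mathcal N\left(\mathbf 0,\begin{pmatrix}\boldsymbol\Sigma_X&\boldsymbol\Sigma_{XY}\\ \boldsymbol\Sigma_{XY}^\top&\boldsymbol\Sigma_Y\end{pmatrix}\right),$$ where $\boldsymbol\Sigma_X\in\mathbb R^{NL\times NL}$ is positive definite, $\boldsymbol\Sigma_{XY}\in\mathbb R^{NL\times NH}$, $\boldsymbol\Sigma_Y\in\mathbb R^{NH\times NH}$ (all depending on $N$). Assume: 1. (linear model) for some $\mathbf W=\mathbf W_N\in\mathbb R^{L\times H}$ the noise $\mathbf E=\mathbf Y-\mathbf X\mathbf W$ is independent of $\mathbf X$; 2. $\boldsymbol\Sigma_{\rm res}=\boldsymbol\Sigma_Y-\boldsymbol\Sigma_{XY}^\top\boldsymbol\Sigma_X^{-1}\boldsymbol\Sigma_{XY}\approx\boldsymbol\Sigma_{\rm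 res}^{(0)}\otimes\mathbf I_N$ for a fixed $\boldsymbol\Sigma_{\rm res}^{(0)}\in\mathbb R^{H\times H}$, in the sense that $\|\boldsymbol\Sigma_{\rm res}-\boldsymbol\Sigma_{\rm res}^{(0)}\otimes\mathbf I_N\|_{\rm op}\to0$ as $N\to\infty$; 3. $\frac1N\mathbb E[\mathbf X^\top\mathbf X]\to\tilde{\boldsymbol\Sigma}_X$ as $N\to\infty$ for a positive definite $\tilde{\boldsymbol\Sigma}_X\in\mathbb R^{L\times L}$, and $\frac1{N^2}\|\boldsymbol\Sigma_X\|_F^2\to0$. (Conditions 2 and 3 hold for instance when the rows of $(\mathbf X,\mathbf Y)$ are i.i.d. and do not depend on $N$, with $\tilde{\boldsymbol\Sigma}_X$ positive definite the covariance of a row of $\mathbf X$.) Then the least-squares estimator $\hat{\mathbf W}=(\mathbf X^\top\mathbf X)^{-1}\mathbf X^\top\mathbf Y$ and the population coefficient matrix $\mathbf W_\star=\left(\frac1N\mathbb E[\mathbf X^\top\mathbf X]\right)^{-1}\frac1N\mathbb E[\mathbf X^\top\mathbf Y]$ satisfy, as $N\to\infty$, $$\sqrt N\left(\operatorname{vec}\hat{\mathbf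 W}-\operatorname{vec}\mathbf W_\star\right)\xrightarrow{d}\mathcal N\left(\mathbf 0,\ \boldsymbol\Sigma_{\rm res}^{(0)}\otimes\tilde{\boldsymbol\Sigma}_X^{-1}\right).$$ (b) Let $L,H\ge1$, let $(\varepsilon_t)_{t\ge0}$ be i.i.d. $\mathcal N(0,v)$ with $v>0$, and let $\hat{\mathbf W}_T=(\mathbf X^\top\mathbf X)^{-1}\mathbf X^\top\mathbf Y$ be the linear forecaster fitted by least squares to the observed series $\varepsilon_0,\dots,\varepsilon_{T-1}$, where the rows of $\mathbf X$ and $\mathbf Y$ are all the history segments $(\varepsilon_t,\varepsilon_{t-1},\dots,\varepsilon_{t-L+1})$ and the corresponding future segments $(\varepsilon_{t+1},\dots,\varepsilon_{t+H})$ contained in the series. Then the population coefficient matrix is $\mathbf 0$, and $\hat{\mathbf W}_T$ converges to it at the exact rate $1/\sqrt T$ in probability: for every $\delta>0$ there are constants $0<c<C$ such that, for all sufficiently large $T$, $$\mathbb P\left(\frac{c}{\sqrt T}\le\|\hat{\mathbf W}_T\|_F\le\frac{C}{\sqrt T}\right)\ge1-\delta.$$ (Where $\mathbf X^\top\mathbf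 X$, or its expectation, is singular, its inverse is read as $\mathbf 0$; this does not affect the limits.) -/

import Mathlib

open MeasureTheory ProbabilityTheory Filter Topology
open scoped Matrix Kronecker NNReal

noncomputable section

namespace OLS

/-- `vec A` (the columns of `A` stacked), as a vector of a Euclidean space; its norm is the
Frobenius norm of `A`. Its coordinates are indexed by pairs (column, row). -/
def evec {m n : Type*} (A : Matrix m n ℝ) : EuclideanSpace ℝ (n × m) :=
  WithLp.toLp 2 A.vec

/-- The vector obtained by putting `vec X` on top of `vec Y`. -/
def stackVec {N L H : ℕ} (X : Matrix (Fin N) (Fin L) ℝ) (Y : Matrix (Fin N) (Fin H) ℝ) :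
    EuclideanSpace ℝ ((Fin L × Fin N) ⊕ (Fin H × Fin N)) :=
  WithLp.toLp 2 (Sum.elim X.vec Y.vec)

/-- The least-squares estimator `(XᵀX)⁻¹ XᵀY`. -/
def estimator {N L H : ℕ} (X : Matrix (Fin N) (Fin L) ℝ) (Y : Matrix (Fin N) (Fin H) ℝ) :
    Matrix (Fin L) (Fin H) ℝ :=
  (Xᵀ * X)⁻¹ * (Xᵀ * Y)

/-- The averaged second moment matrix `(1/N) 𝔼[XᵀY]`. -/
def moment {Ω : Type*} [MeasurableSpace Ω] (P : Measure Ω) {N L H : ℕ}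
    (X : Ω → Matrix (Fin N) (Fin L) ℝ) (Y : Ω → Matrix (Fin N) (Fin H) ℝ) :
    Matrix (Fin L) (Fin H) ℝ :=
  Matrix.of fun k j => (1 / (N : ℝ)) * ∫ ω, ((X ω)ᵀ * Y ω) k j ∂P

/-- The population coefficient matrix `((1/N) 𝔼[XᵀX])⁻¹ (1/N) 𝔼[XᵀY]`. -/
def popCoef {Ω : Type*} [MeasurableSpace Ω] (P : Measure Ω) {N L H : ℕ}
    (X : Ω → Matrix (Fin N) (Fin L) ℝ) (Y : Ω → Matrix (Fin N) (Fin H) ℝ) :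
    Matrix (Fin L) (Fin H) ℝ :=
  (moment P X X)⁻¹ * moment P X Y

/-- The covariance matrix of `(vec X, vec Y)`, assembled from its blocks. -/
def jointCov {N L H : ℕ} (CX : Matrix (Fin L × Fin N) (Fin L × Fin N) ℝ)
    (CXY : Matrix (Fin L × Fin N) (Fin H × Fin N) ℝ)
    (CY : Matrix (Fin H × Fin N) (Fin H × Fin N) ℝ) :
    Matrix ((Fin L × Fin N) ⊕ (Fin H × Fin N)) ((Fin L × Fin N) ⊕ (Fin H × Fin N)) ℝ :=
  Matrix.fromBlocks CX CXY CXYᵀ CY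

/-- The residual covariance `Σ_Y - Σ_YX Σ_X⁻¹ Σ_XY`. -/
def resCov {N L H : ℕ} (CX : Matrix (Fin L × Fin N) (Fin L × Fin N) ℝ)
    (CXY : Matrix (Fin L × Fin N) (Fin H × Fin N) ℝ)
    (CY : Matrix (Fin H × Fin N) (Fin H × Fin N) ℝ) :
    Matrix (Fin H × Fin N) (Fin H × Fin N) ℝ :=
  CY - CXYᵀ * CX⁻¹ * CXY

/-- The number of windows of length `L + H` in a series of length `T` (zero if `T < L + H`). -/
def numWindows (L H T : ℕ) : ℕ := T + 1 - (L + H)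

/-- The history segments of the observed series `y 0, …, y (T - 1)`: row `i` is
`(y t, y (t - 1), …, y (t - L + 1))` with `t = i + L - 1`. -/
def history (L H T : ℕ) (y : ℕ → ℝ) : Matrix (Fin (numWindows L H T)) (Fin L) ℝ :=
  Matrix.of fun i k => y ((i : ℕ) + (k.rev : ℕ))

/-- The future segments of the observed series: row `i` is `(y (t + 1), …, y (t + H))` with
`t = i + L - 1`. -/
def future (L H T : ℕ) (y : ℕ → ℝ) : Matrix (Fin (numWindows L H T)) (Fin H) ℝ :=
  Matrix.of fun i j => y ((i : ℕ) + L + (j : ℕ))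

end OLS

end

/-! Asymptotic normality comes from conditioning on the design. Writing `Y = XW + E`, the estimation
error is `(XᵀX)⁻¹XᵀE` whenever the Gram matrix is invertible. Since `E` is independent of `X` and
Gaussian with covariance the Schur complement `resCov`, the scaled error is, given `X`, centred
Gaussian, and its characteristic function at `vec B` is `exp(-q/2)` for an explicit quadratic form
`q` of the design (`charFun_noise`, `charFun_scaled_estimator`). If the residual covariance were
exactly `R₀ ⊗ I`, then `q` would be the form of `R₀ ⊗ (XᵀX/N)⁻¹`; the discrepancy is bounded by the
operator norm in the hypothesis (`abs_quadratic_sub_le`). Isserlis' formula bounds the variance of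
the entries of `XᵀX/N` by a multiple of `‖Σ_X‖_F²/N²`, so `XᵀX/N → S` in probability. The
conditional characteristic functions are bounded by one, so their expectations converge to that of
the limit law. The population coefficient is eventually `W` itself (`popCoef_eq`).

For white noise, the Gram matrix of `n` windows divided by `n` tends to `v I`, so the estimator has
the size of `XᵀY/n`. Every entry of `XᵀY` has variance of order `n`, which gives the upper rate. For
the lower rate one entry suffices: it is a lag-one sum `∑ εᵢεᵢ₊₁`, which, given the even-indexed
noise, is linear in the odd-indexed noise with squared coefficients summing to order `n`. A Gaussian
of that variance rarely lies in an interval of length `o(√n)` (`measureReal_abs_sum_le`,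
`measureReal_abs_sum_lag_le`). -/

namespace OLS

/-! ### Fourth moments of Gaussian vectors and Chebyshev bounds for bilinear sums. -/

section Isserlis

/-- The moment is the fourth derivative at zero of the moment generating function `exp(vt²/2)`, all
of whose derivatives are polynomials times `exp(vt²/2)`. -/
theorem integral_pow_four_gaussianReal (v : ℝ≥0) :
    ∫ x, x ^ 4 ∂gaussianReal 0 v = 3 * (v : ℝ) ^ 2 := by
  have h0 : (0 : ℝ) ∈ interior (integrableExpSet id (gaussianReal 0 v)) := by simp
  have h := iteratedDeriv_mgf_zero h0 4
  have hder : ∀ (p q : ℝ → ℝ), (∀ t, HasDerivAt p (q t) t) → ∀ t,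
      HasDerivAt (fun t ↦ p t * Real.exp ((v : ℝ) * t ^ 2 / 2))
        ((q t + v * t * p t) * Real.exp ((v : ℝ) * t ^ 2 / 2)) t := by
    intro p q hp t
    have h1 : HasDerivAt (fun t : ℝ ↦ (v : ℝ) * t ^ 2 / 2) (v * t) t := by
      refine (((hasDerivAt_pow 2 t).const_mul (v : ℝ)).div_const 2).congr_deriv ?_
      norm_num
      ring
    refine ((hp t).mul h1.exp).congr_deriv ?_
    ring
  have d1 : deriv (fun t : ℝ ↦ Real.exp ((v : ℝ) * t ^ 2 / 2)) =
      fun t ↦ (v * t) * Real.exp ((v : ℝ) * t ^ 2 / 2) := by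
    ext t
    have := (hder (fun _ ↦ 1) (fun _ ↦ 0) (fun t ↦ hasDerivAt_const _ _) t).deriv
    simpa using this
  have d2 : deriv (fun t : ℝ ↦ (v * t) * Real.exp ((v : ℝ) * t ^ 2 / 2)) =
      fun t ↦ (v + v ^ 2 * t ^ 2) * Real.exp ((v : ℝ) * t ^ 2 / 2) := by
    ext t
    rw [(hder (fun t ↦ v * t) (fun _ ↦ v)
      (fun t ↦ by simpa using (hasDerivAt_id t).const_mul (v : ℝ)) t).deriv]
    ring
  have d3 : deriv (fun t : ℝ ↦ (v + v ^ 2 * t ^ 2) * Real.exp ((v : ℝ) * t ^ 2 / 2)) =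
      fun t ↦ (3 * v ^ 2 * t + v ^ 3 * t ^ 3) * Real.exp ((v : ℝ) * t ^ 2 / 2) := by
    ext t
    rw [(hder (fun t ↦ v + v ^ 2 * t ^ 2) (fun t ↦ v ^ 2 * (2 * t))
      (fun t ↦ by
        simpa using ((hasDerivAt_pow 2 t).const_mul ((v : ℝ) ^ 2)).const_add (v : ℝ)) t).deriv]
    ring
  have d4 : deriv (fun t : ℝ ↦ (3 * v ^ 2 * t + v ^ 3 * t ^ 3) *
      Real.exp ((v : ℝ) * t ^ 2 / 2)) 0 = 3 * (v : ℝ) ^ 2 := by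
    rw [(hder (fun t ↦ 3 * v ^ 2 * t + v ^ 3 * t ^ 3) (fun t ↦ 3 * v ^ 2 + v ^ 3 * (3 * t ^ 2))
      (fun t ↦ by
        simpa using ((hasDerivAt_id t).const_mul (3 * (v : ℝ) ^ 2)).fun_add
          ((hasDerivAt_pow 3 t).const_mul ((v : ℝ) ^ 3))) 0).deriv]
    simp
  rw [mgf_id_gaussianReal] at h
  simp only [iteratedDeriv_succ, iteratedDeriv_zero, zero_mul, zero_add] at h
  rw [d1, d2, d3, d4] at h
  simpa using h.symm

variable {Ω : Type*} [MeasurableSpace Ω] {P : Measure Ω}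

theorem integral_pow_four_of_hasGaussianLaw {Z : Ω → ℝ} (hZ : HasGaussianLaw Z P)
    (h0 : ∫ ω, Z ω ∂P = 0) : ∫ ω, Z ω ^ 4 ∂P = 3 * (∫ ω, Z ω ^ 2 ∂P) ^ 2 := by
  have : IsProbabilityMeasure P := hZ.isProbabilityMeasure
  have h1 := hZ.map_eq_gaussianReal
  have h2 : Var[Z; P] = ∫ ω, Z ω ^ 2 ∂P := variance_of_integral_eq_zero hZ.aemeasurable h0
  have h3 : ∫ x, x ^ 4 ∂(P.map Z) = ∫ ω, Z ω ^ 4 ∂P :=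
    integral_map hZ.aemeasurable (by fun_prop)
  rw [← h3, h1, h0, integral_pow_four_gaussianReal, Real.coe_toNNReal _ (variance_nonneg _ _), h2]

variable {ι : Type*} {u : ι → Ω → ℝ}

theorem memLp_mul_of_hasGaussianLaw (hu : HasGaussianLaw (fun ω i ↦ u i ω) P) (a b : ι) :
    MemLp (fun ω ↦ u a ω * u b ω) 2 P := by
  have : ENNReal.HolderTriple 4 4 2 := ⟨by
    rw [← two_mul, show (4 : ENNReal) = 2 * 2 by norm_num,
      ENNReal.mul_inv (by simp) (by simp), ← mul_assoc, ENNReal.mul_inv_cancel (by simp) (by simp),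
      one_mul]⟩
  exact ((hu.eval b).memLp (p := 4) (by simp)).mul ((hu.eval a).memLp (p := 4) (by simp))

theorem integrable_mul_of_hasGaussianLaw (hu : HasGaussianLaw (fun ω i ↦ u i ω) P) (a b : ι) :
    Integrable (fun ω ↦ u a ω * u b ω) P :=
  (hu.eval a).memLp_two.integrable_mul (hu.eval b).memLp_two

/-- **Isserlis' theorem** for the fourth moments of a centred Gaussian vector. -/
theorem integral_mul_mul_mul [Fintype ι] (hu : HasGaussianLaw (fun ω i ↦ u i ω) P)
    (h0 : ∀ i, ∫ ω, u i ω ∂P = 0) (a b c d : ι) :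
    ∫ ω, u a ω * u b ω * (u c ω * u d ω) ∂P =
      (∫ ω, u a ω * u b ω ∂P) * (∫ ω, u c ω * u d ω ∂P) +
      (∫ ω, u a ω * u c ω ∂P) * (∫ ω, u b ω * u d ω ∂P) +
      (∫ ω, u a ω * u d ω ∂P) * (∫ ω, u b ω * u c ω ∂P) := by
  have hi (i : ι) : Integrable (u i) P := (hu.eval i).integrable
  have hii (i j : ι) : Integrable (fun ω ↦ u i ω * u j ω) P :=
    integrable_mul_of_hasGaussianLaw hu i j
  have hii' (i : ι) : Integrable (fun ω ↦ u i ω ^ 2) P := by simpa [sq] using hii i i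
  -- Polarisation: the signed sum of `(a ± b ± c ± d)⁴` over the eight sign patterns retains only
  -- the monomial `abcd`, with coefficient `8 · 24 = 192`. Each fourth moment is three times a
  -- squared second moment.
  let σ : Bool → ℝ := fun p ↦ if p then 1 else -1
  let Z : Bool × Bool × Bool → Ω → ℝ := fun s ω ↦
    u a ω + σ s.1 * u b ω + σ s.2.1 * u c ω + σ s.2.2 * u d ω
  have hZ (s) : HasGaussianLaw (Z s) P := by
    have := hu.map_fun (ContinuousLinearMap.proj (R := ℝ) (φ := fun _ : ι ↦ ℝ) a +
      σ s.1 • ContinuousLinearMap.proj (R := ℝ) (φ := fun _ : ι ↦ ℝ) b +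
      σ s.2.1 • ContinuousLinearMap.proj (R := ℝ) (φ := fun _ : ι ↦ ℝ) c +
      σ s.2.2 • ContinuousLinearMap.proj (R := ℝ) (φ := fun _ : ι ↦ ℝ) d)
    simpa [Z] using this
  have hZ0 (s) : ∫ ω, Z s ω ∂P = 0 := by
    simp only [Z]
    rw [integral_add (by fun_prop) (by fun_prop), integral_add (by fun_prop) (by fun_prop),
      integral_add (by fun_prop) (by fun_prop)]
    simp [integral_const_mul, h0]
  have hZ2 (s) : ∫ ω, Z s ω ^ 2 ∂P = (∫ ω, u a ω * u a ω ∂P) + σ s.1 ^ 2 * (∫ ω, u b ω * u b ω ∂P)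
      + σ s.2.1 ^ 2 * (∫ ω, u c ω * u c ω ∂P) + σ s.2.2 ^ 2 * (∫ ω, u d ω * u d ω ∂P)
      + 2 * σ s.1 * (∫ ω, u a ω * u b ω ∂P) + 2 * σ s.2.1 * (∫ ω, u a ω * u c ω ∂P)
      + 2 * σ s.2.2 * (∫ ω, u a ω * u d ω ∂P) + 2 * σ s.1 * σ s.2.1 * (∫ ω, u b ω * u c ω ∂P)
      + 2 * σ s.1 * σ s.2.2 * (∫ ω, u b ω * u d ω ∂P)
      + 2 * σ s.2.1 * σ s.2.2 * (∫ ω, u c ω * u d ω ∂P) := by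
    simp_rw [← integral_const_mul]
    repeat rw [← integral_add (by fun_prop) (by fun_prop)]
    congr 1 with ω
    simp only [Z]
    ring
  have hZ4 (s) : Integrable (fun ω ↦ Z s ω ^ 4) P := by
    have h4 := ((hZ s).memLp (p := 4) (by simp)).integrable_norm_pow (by simp)
    refine (integrable_congr (ae_of_all _ fun ω ↦ ?_)).mp h4
    simp [Even.pow_abs (by decide : Even 4)]
  have key : ∫ ω, 192 * (u a ω * u b ω * (u c ω * u d ω)) ∂P =
      ∑ s, ∫ ω, σ s.1 * σ s.2.1 * σ s.2.2 * Z s ω ^ 4 ∂P := by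
    rw [← integral_finsetSum _ (fun s _ ↦ (hZ4 s).const_mul _)]
    congr 1 with ω
    simp [Fintype.sum_prod_type, Z, σ]
    ring
  simp_rw [integral_const_mul, fun s ↦ integral_pow_four_of_hasGaussianLaw (hZ s) (hZ0 s), hZ2] at key
  simp only [Fintype.sum_prod_type, Fintype.sum_bool, σ, if_true, Bool.false_eq_true, if_false] at key
  linear_combination key / 192

/-- The variance of a bilinear expression in a centred Gaussian vector. -/
theorem variance_sum_mul [Fintype ι] (hu : HasGaussianLaw (fun ω i ↦ u i ω) P)
    (h0 : ∀ i, ∫ ω, u i ω ∂P = 0) {κ : Type*} [Fintype κ] (p q : κ → ι) :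
    Var[fun ω ↦ ∑ i, u (p i) ω * u (q i) ω; P] =
      ∑ i, ∑ j, ((∫ ω, u (p i) ω * u (p j) ω ∂P) * (∫ ω, u (q i) ω * u (q j) ω ∂P) +
        (∫ ω, u (p i) ω * u (q j) ω ∂P) * (∫ ω, u (q i) ω * u (p j) ω ∂P)) := by
  have : IsProbabilityMeasure P := hu.isProbabilityMeasure
  rw [variance_fun_sum fun i ↦ memLp_mul_of_hasGaussianLaw hu _ _]
  refine Finset.sum_congr rfl fun i _ ↦ Finset.sum_congr rfl fun j _ ↦ ?_
  rw [covariance_eq_sub (memLp_mul_of_hasGaussianLaw hu _ _) (memLp_mul_of_hasGaussianLaw hu _ _)]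
  simp only [Pi.mul_apply]
  rw [integral_mul_mul_mul hu h0]
  ring

/-- Chebyshev's inequality for a bilinear expression in a Gaussian vector. -/
theorem measure_le_abs_sum_mul_sub (hu : HasGaussianLaw (fun ω i ↦ u i ω) P)
    {κ : Type*} [Fintype κ] (p q : κ → ι) {B c : ℝ} (hc : 0 < c)
    (hB : Var[fun ω ↦ ∑ i, u (p i) ω * u (q i) ω; P] ≤ B) :
    P.real {ω | c ≤ |(∑ i, u (p i) ω * u (q i) ω) - ∑ i, ∫ ω, u (p i) ω * u (q i) ω ∂P|} ≤
      B / c ^ 2 := by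
  have : IsProbabilityMeasure P := hu.isProbabilityMeasure
  have h := meas_ge_le_variance_div_sq
    (memLp_finsetSum Finset.univ fun i _ ↦ memLp_mul_of_hasGaussianLaw hu (p i) (q i)) hc
  rw [integral_finsetSum _ fun i _ ↦ integrable_mul_of_hasGaussianLaw hu _ _] at h
  refine (ENNReal.toReal_le_of_le_ofReal
    (div_nonneg (variance_nonneg _ _) (sq_nonneg c)) h).trans ?_
  gcongr

end Isserlis

/-! ### Convergence in probability on varying probability spaces. -/

section Convergence

variable {Ω : ℕ → Type*} [∀ N, MeasurableSpace (Ω N)] {P : ∀ N, Measure (Ω N)}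
  [∀ N, IsProbabilityMeasure (P N)]

/-- If the entries of random matrices are close in probability to a sequence converging to `S`,
then the random matrices lie in any neighbourhood of `S` with probability tending to one. -/
theorem tendsto_measureReal_notMem_nhds {m n : Type*} [Fintype m] [Fintype n]
    {M : ∀ N, Ω N → Matrix m n ℝ} {A : ℕ → Matrix m n ℝ} {S : Matrix m n ℝ}
    (hA : Tendsto A atTop (𝓝 S))
    (h : ∀ k l, ∀ ε > 0,
      Tendsto (fun N ↦ (P N).real {ω | ε ≤ |M N ω k l - A N k l|}) atTop (𝓝 0))
    {U : Set (Matrix m n ℝ)} (hU : U ∈ 𝓝 S) :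
    Tendsto (fun N ↦ (P N).real {ω | M N ω ∉ U}) atTop (𝓝 0) := by
  obtain ⟨ε, hε, hεU⟩ : ∃ ε > 0, ∀ B : Matrix m n ℝ, (∀ k l, |B k l - S k l| < ε) → B ∈ U := by
    obtain ⟨ε, hε, hb⟩ := Metric.mem_nhds_iff (α := m → n → ℝ).mp hU
    refine ⟨ε, hε, fun B hB ↦ hb ?_⟩
    exact (dist_pi_lt_iff (β := m) (X := fun _ ↦ n → ℝ) hε).mpr fun k ↦
      (dist_pi_lt_iff hε).mpr fun l ↦ hB k l
  have hsum : Tendsto (fun N ↦ ∑ k, ∑ l, (P N).real {ω | ε / 2 ≤ |M N ω k l - A N k l|})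
      atTop (𝓝 0) := by
    simpa using tendsto_finsetSum Finset.univ fun k _ ↦
      tendsto_finsetSum Finset.univ fun l _ ↦ h k l (ε / 2) (half_pos hε)
  have hA' : ∀ᶠ N in atTop, ∀ k l, |A N k l - S k l| < ε / 2 := by
    simp_rw [eventually_all]
    intro k l
    have := (tendsto_pi_nhds.mp (tendsto_pi_nhds.mp hA k) l)
    exact (Metric.tendsto_nhds.mp this) (ε / 2) (half_pos hε)
  refine squeeze_zero' (Eventually.of_forall fun N ↦ measureReal_nonneg) ?_ hsum
  filter_upwards [hA'] with N hN
  have hsub : {ω | M N ω ∉ U} ⊆ ⋃ k, ⋃ l, {ω | ε / 2 ≤ |M N ω k l - A N k l|} := by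
    intro ω hω
    by_contra hcon
    simp only [Set.mem_iUnion, Set.mem_ofPred_eq, not_exists, not_le] at hcon
    refine hω (hεU _ fun k l ↦ ?_)
    calc |M N ω k l - S k l| ≤ |M N ω k l - A N k l| + |A N k l - S k l| := abs_sub_le _ _ _
      _ < ε := by linarith [hcon k l, hN k l]
  exact (measureReal_mono hsub).trans ((measureReal_iUnion_fintype_le _).trans
    (Finset.sum_le_sum fun k _ ↦ measureReal_iUnion_fintype_le _))

/-- Bounded convergence for variables on varying probability spaces that converge in probability
to a constant. -/
theorem tendsto_integral_of_tendsto_measureReal {f : ∀ N, Ω N → ℂ} {c : ℂ}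
    (hf : ∀ N, AEStronglyMeasurable (f N) (P N)) (hf1 : ∀ N ω, ‖f N ω‖ ≤ 1) (hc : ‖c‖ ≤ 1)
    (h : ∀ ε > 0, Tendsto (fun N ↦ (P N).real {ω | ε ≤ ‖f N ω - c‖}) atTop (𝓝 0)) :
    Tendsto (fun N ↦ ∫ ω, f N ω ∂P N) atTop (𝓝 c) := by
  rw [Metric.tendsto_atTop']
  intro ε hε
  -- On the exceptional event the integrand is at most 2, so probability below `ε / 4` costs less
  -- than `ε / 2`.
  obtain ⟨N₀, hN₀⟩ := (Metric.tendsto_atTop'.mp (h (ε / 2) (half_pos hε))) (ε / 4) (by positivity)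
  refine ⟨N₀, fun N hN ↦ ?_⟩
  have hP := hN₀ N hN
  rw [Real.dist_0_eq_abs, abs_of_nonneg measureReal_nonneg] at hP
  set A := {ω | ε / 2 ≤ ‖f N ω - c‖} with hA
  have hAm : NullMeasurableSet A (P N) :=
    nullMeasurableSet_le aemeasurable_const ((hf N).sub aestronglyMeasurable_const).norm.aemeasurable
  have hfi : Integrable (f N) (P N) := Integrable.of_bound (hf N) 1 (ae_of_all _ (hf1 N))
  rw [dist_eq_norm]
  calc ‖(∫ ω, f N ω ∂P N) - c‖ = ‖∫ ω, (f N ω - c) ∂P N‖ := by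
        rw [integral_sub hfi (integrable_const _)]; simp
    _ ≤ ∫ ω, ‖f N ω - c‖ ∂P N := norm_integral_le_integral_norm _
    _ ≤ ∫ ω, (ε / 2 + A.indicator (fun _ ↦ (2 : ℝ)) ω) ∂P N := by
        refine integral_mono (hfi.sub (integrable_const _)).norm
          ((integrable_const _).add ((integrable_const _).indicator₀ hAm)) fun ω ↦ ?_
        by_cases hω : ω ∈ A
        · have := norm_sub_le (f N ω) c
          simp only [Set.indicator_of_mem hω]
          linarith [hf1 N ω]
        · simp only [Set.indicator_of_notMem hω, add_zero]
          exact (not_le.mp hω).le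
    _ = ε / 2 + 2 * (P N).real A := by
        rw [integral_add (integrable_const _) ((integrable_const _).indicator₀ hAm),
          integral_indicator₀ hAm]
        simp [mul_comm]
    _ < ε := by linarith

end Convergence

/-! ### Characteristic functions conditional on an independent variable. -/

section Conditional

variable {Ω E F : Type*} [MeasurableSpace Ω] [MeasurableSpace E]
  [NormedAddCommGroup F] [InnerProductSpace ℝ F] [MeasurableSpace F] [BorelSpace F]
  [SecondCountableTopology F] {P : Measure Ω} [IsProbabilityMeasure P]

open scoped RealInnerProductSpace in
/-- Integrating out an independent variable `e` by means of its characteristic function. -/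
theorem integral_exp_inner_of_indepFun {x : Ω → E} {e : Ω → F} (hx : AEMeasurable x P)
    (he : AEMeasurable e P) (hxe : IndepFun x e P) {h : E → ℝ} (hh : Measurable h) {g : E → F}
    (hg : Measurable g) :
    ∫ ω, Complex.exp ((h (x ω) + ⟪e ω, g (x ω)⟫ : ℝ) * Complex.I) ∂P =
      ∫ ω, Complex.exp (h (x ω) * Complex.I) * charFun (P.map e) (g (x ω)) ∂P := by
  have hprod := (indepFun_iff_map_prod_eq_prod_map_map hx he).mp hxe
  have : IsProbabilityMeasure (P.map x) := Measure.isProbabilityMeasure_map hx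
  have : IsProbabilityMeasure (P.map e) := Measure.isProbabilityMeasure_map he
  have hF : Measurable fun z : E × F ↦ Complex.exp ((h z.1 + ⟪z.2, g z.1⟫ : ℝ) * Complex.I) := by
    fun_prop
  have h1 : ∫ ω, Complex.exp ((h (x ω) + ⟪e ω, g (x ω)⟫ : ℝ) * Complex.I) ∂P =
      ∫ z, Complex.exp ((h z.1 + ⟪z.2, g z.1⟫ : ℝ) * Complex.I) ∂((P.map x).prod (P.map e)) := by
    rw [← hprod, integral_map (hx.prodMk he) hF.aestronglyMeasurable]
  have hchar : Measurable fun a ↦ charFun (P.map e) (g a) := by fun_prop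
  rw [h1, integral_prod]
  · rw [integral_map hx]
    · congr 1 with ω
      rw [charFun_apply, ← integral_const_mul]
      congr 1 with y
      rw [← Complex.exp_add]
      push_cast
      ring_nf
    · exact hF.stronglyMeasurable.integral_prod_right.aestronglyMeasurable
  · refine Integrable.of_bound hF.aestronglyMeasurable 1 (ae_of_all _ fun z ↦ ?_)
    rw [Complex.norm_exp_ofReal_mul_I]

end Conditional

/-! ### Measurability of the estimator. -/

section Measurability

variable {α : Type*} [MeasurableSpace α]

theorem measurable_matrix_mul_apply {m n p : Type*} [Fintype n] {f : α → Matrix m n ℝ}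
    {g : α → Matrix n p ℝ} (hf : ∀ i j, Measurable fun a ↦ f a i j)
    (hg : ∀ i j, Measurable fun a ↦ g a i j) (i : m) (j : p) :
    Measurable fun a ↦ (f a * g a) i j := by
  simp only [Matrix.mul_apply]
  exact Finset.measurable_sum _ fun k _ ↦ (hf i k).mul (hg k j)

/-- Inversion is not continuous at singular matrices, where it is read as zero, but the adjugate
over the determinant is measurable everywhere. -/
theorem measurable_matrix_inv_apply {n : Type*} [Fintype n] [DecidableEq n] {f : α → Matrix n n ℝ}
    (hf : ∀ i j, Measurable fun a ↦ f a i j) (i j : n) : Measurable fun a ↦ (f a)⁻¹ i j := by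
  have hf' : Measurable fun (a : α) (i j : n) ↦ f a i j :=
    measurable_pi_lambda _ fun i ↦ measurable_pi_lambda _ fun j ↦ hf i j
  have h1 : Continuous fun A : n → n → ℝ ↦ (Matrix.of A).det := continuous_id.matrix_det
  have h2 : Continuous fun A : n → n → ℝ ↦ (Matrix.of A).adjugate i j :=
    continuous_id.matrix_adjugate.matrix_elem i j
  simp only [Matrix.inv_def, Ring.inverse_eq_inv', Matrix.smul_apply, smul_eq_mul]
  exact (h1.measurable.comp hf').inv.mul (h2.measurable.comp hf')

theorem measurable_evec {m n : Type*} {f : α → Matrix m n ℝ}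
    (hf : ∀ i j, Measurable fun a ↦ f a i j) : Measurable fun a ↦ evec (f a) :=
  (WithLp.measurable_toLp 2 (n × m → ℝ)).comp (measurable_pi_lambda _ fun q ↦ hf q.2 q.1)

theorem measurable_estimator_apply {N L H : ℕ} {f : α → Matrix (Fin N) (Fin L) ℝ}
    {g : α → Matrix (Fin N) (Fin H) ℝ} (hf : ∀ i j, Measurable fun a ↦ f a i j)
    (hg : ∀ i j, Measurable fun a ↦ g a i j) (i : Fin L) (j : Fin H) :
    Measurable fun a ↦ estimator (f a) (g a) i j :=
  measurable_matrix_mul_apply (measurable_matrix_inv_apply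
    (measurable_matrix_mul_apply (fun i j ↦ hf j i) hf))
    (measurable_matrix_mul_apply (fun i j ↦ hf j i) hg) i j

end Measurability

/-! ### Coordinates of a centred Gaussian vector. -/

section MultivariateGaussian

variable {Ω : Type*} [MeasurableSpace Ω] {P : Measure Ω} {ι : Type*} [Fintype ι] [DecidableEq ι]
  {z : Ω → EuclideanSpace ℝ ι} {J : Matrix ι ι ℝ}

theorem hasGaussianLaw_apply (hz : HasLaw z (multivariateGaussian 0 J) P) :
    HasGaussianLaw (fun ω i ↦ z ω i) P :=
  hz.hasGaussianLaw.map_equiv_fun (EuclideanSpace.equiv ι ℝ)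

theorem integral_apply_eq_zero (hz : HasLaw z (multivariateGaussian 0 J) P) (i : ι) :
    ∫ ω, z ω i ∂P = 0 := by
  have h1 := hz.integral_comp (f := fun x : EuclideanSpace ℝ ι ↦ x i) (by fun_prop)
  have h2 := (EuclideanSpace.proj i : EuclideanSpace ℝ ι →L[ℝ] ℝ).integral_comp_comm
    (IsGaussian.integrable_fun_id (μ := multivariateGaussian 0 J))
  rw [integral_id_multivariateGaussian] at h2
  exact h1.trans (by simpa using h2)

theorem integral_apply_mul_apply (hJ : J.PosSemidef)
    (hz : HasLaw z (multivariateGaussian 0 J) P) (i j : ι) :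
    ∫ ω, z ω i * z ω j ∂P = J i j := by
  have h1 := hz.integral_comp (f := fun x : EuclideanSpace ℝ ι ↦ x i * x j) (by fun_prop)
  have hid : HasLaw id (multivariateGaussian 0 J) (multivariateGaussian 0 J) := .id
  have h0 := integral_apply_eq_zero hid
  have h2 := covariance_eval_multivariateGaussian (μ := 0) hJ i j
  have hL (i : ι) : MemLp (fun x : EuclideanSpace ℝ ι ↦ x i) 2 (multivariateGaussian 0 J) :=
    ((hasGaussianLaw_apply hid).eval i).memLp_two
  rw [covariance_eq_sub (hL i) (hL j)] at h2
  simp only [id_eq] at h0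
  rw [h0, zero_mul, sub_zero] at h2
  exact h1.trans h2

end MultivariateGaussian

/-! ### The Gaussian linear model at a fixed sample size. -/

section Model

variable {Ω : Type*} [MeasurableSpace Ω] {P : Measure Ω} {N L H : ℕ}
  {X : Ω → Matrix (Fin N) (Fin L) ℝ} {Y : Ω → Matrix (Fin N) (Fin H) ℝ}
  {CX : Matrix (Fin L × Fin N) (Fin L × Fin N) ℝ}
  {CXY : Matrix (Fin L × Fin N) (Fin H × Fin N) ℝ}
  {CY : Matrix (Fin H × Fin N) (Fin H × Fin N) ℝ} {W : Matrix (Fin L) (Fin H) ℝ}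

theorem aemeasurable_design_apply (hZ : AEMeasurable (fun ω ↦ stackVec (X ω) (Y ω)) P) (i : Fin N)
    (k : Fin L) : AEMeasurable (fun ω ↦ X ω i k) P :=
  (show Measurable fun x : EuclideanSpace ℝ ((Fin L × Fin N) ⊕ (Fin H × Fin N)) ↦
    x (Sum.inl (k, i)) by fun_prop).comp_aemeasurable hZ

theorem aemeasurable_response_apply (hZ : AEMeasurable (fun ω ↦ stackVec (X ω) (Y ω)) P)
    (i : Fin N) (k : Fin H) : AEMeasurable (fun ω ↦ Y ω i k) P :=
  (show Measurable fun x : EuclideanSpace ℝ ((Fin L × Fin N) ⊕ (Fin H × Fin N)) ↦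
    x (Sum.inr (k, i)) by fun_prop).comp_aemeasurable hZ

theorem moment_design_apply
    (hZ : HasLaw (fun ω ↦ stackVec (X ω) (Y ω)) (multivariateGaussian 0 (jointCov CX CXY CY)) P)
    (k l : Fin L) :
    moment P X X k l = (1 / (N : ℝ)) * ∑ i, ∫ ω, X ω i k * X ω i l ∂P := by
  simp only [moment, Matrix.of_apply, Matrix.mul_apply, Matrix.transpose_apply]
  have hi (i : Fin N) : Integrable (fun ω ↦ X ω i k * X ω i l) P :=
    integrable_mul_of_hasGaussianLaw (hasGaussianLaw_apply hZ) (Sum.inl (k, i)) (Sum.inl (l, i))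
  rw [integral_finsetSum _ fun i _ ↦ hi i]

variable (hJ : (jointCov CX CXY CY).PosSemidef)
  (hZ : HasLaw (fun ω ↦ stackVec (X ω) (Y ω)) (multivariateGaussian 0 (jointCov CX CXY CY)) P)

include hJ hZ

theorem integral_design_mul_design (k l : Fin L) (i j : Fin N) :
    ∫ ω, X ω i k * X ω j l ∂P = CX (k, i) (l, j) :=
  integral_apply_mul_apply hJ hZ (Sum.inl (k, i)) (Sum.inl (l, j))

theorem integral_design_mul_response (k : Fin L) (l : Fin H) (i j : Fin N) :
    ∫ ω, X ω i k * Y ω j l ∂P = CXY (k, i) (l, j) :=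
  integral_apply_mul_apply hJ hZ (Sum.inl (k, i)) (Sum.inr (l, j))

/-- In the linear model the cross-covariance of design and response is determined by the
coefficients. -/
theorem crossCov_eq [IsProbabilityMeasure P]
    (hind : IndepFun (fun ω ↦ evec (X ω)) (fun ω ↦ evec (Y ω - X ω * W)) P) :
    CXY = CX * (W ⊗ₖ (1 : Matrix (Fin N) (Fin N) ℝ)) := by
  have hG := hasGaussianLaw_apply hZ
  have hX0 (k : Fin L) (i : Fin N) : ∫ ω, X ω i k ∂P = 0 :=
    integral_apply_eq_zero hZ (Sum.inl (k, i))
  ext ⟨k, i⟩ ⟨l, j⟩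
  have h1 : IndepFun (fun ω ↦ X ω i k) (fun ω ↦ (Y ω - X ω * W) j l) P :=
    hind.comp (φ := fun x : EuclideanSpace ℝ (Fin L × Fin N) ↦ x (k, i))
      (ψ := fun x : EuclideanSpace ℝ (Fin H × Fin N) ↦ x (l, j)) (by fun_prop) (by fun_prop)
  have hXm := aemeasurable_design_apply hZ.aemeasurable
  have hYm := aemeasurable_response_apply hZ.aemeasurable
  have hEm : AEMeasurable (fun ω ↦ (Y ω - X ω * W) j l) P := by
    simp only [Matrix.sub_apply, Matrix.mul_apply]
    exact (hYm j l).sub (Finset.aemeasurable_fun_sum _ fun m _ ↦ (hXm j m).mul_const _)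
  have h2 := h1.integral_fun_mul_eq_mul_integral (hXm i k).aestronglyMeasurable
    hEm.aestronglyMeasurable
  -- Independence and the centring of `X` already make `𝔼[X E]` vanish; the mean of `E` is
  -- irrelevant.
  rw [hX0, zero_mul] at h2
  have hXX (m : Fin L) : Integrable (fun ω ↦ X ω i k * X ω j m) P :=
    integrable_mul_of_hasGaussianLaw hG (Sum.inl (k, i)) (Sum.inl (m, j))
  have hXY : Integrable (fun ω ↦ X ω i k * Y ω j l) P :=
    integrable_mul_of_hasGaussianLaw hG (Sum.inl (k, i)) (Sum.inr (l, j))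
  have h3 : ∫ ω, X ω i k * (Y ω - X ω * W) j l ∂P =
      CXY (k, i) (l, j) - ∑ m, CX (k, i) (m, j) * W m l := by
    simp only [Matrix.sub_apply, Matrix.mul_apply, mul_sub, Finset.mul_sum, ← mul_assoc]
    rw [integral_sub hXY (integrable_finsetSum _ fun m _ ↦ (hXX m).mul_const _),
      integral_finsetSum _ fun m _ ↦ (hXX m).mul_const _,
      integral_design_mul_response hJ hZ]
    simp only [integral_mul_const, integral_design_mul_design hJ hZ]
  rw [h2] at h3
  rw [Matrix.mul_apply, Fintype.sum_prod_type, ← sub_eq_zero, h3]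
  simp [Matrix.one_apply]

/-- Noise uncorrelated with the design gives `𝔼[XᵀY] = 𝔼[XᵀX] W`, so no limit is involved once the
moment matrix is invertible. -/
theorem popCoef_eq [IsProbabilityMeasure P]
    (hind : IndepFun (fun ω ↦ evec (X ω)) (fun ω ↦ evec (Y ω - X ω * W)) P)
    (hM : IsUnit (moment P X X).det) : popCoef P X Y = W := by
  have hXY : moment P X Y = moment P X X * W := by
    ext k l
    rw [Matrix.mul_apply]
    simp_rw [moment_design_apply hZ, integral_design_mul_design hJ hZ]
    simp only [moment, Matrix.of_apply, Matrix.mul_apply, Matrix.transpose_apply]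
    have hi (i : Fin N) : Integrable (fun ω ↦ X ω i k * Y ω i l) P :=
      integrable_mul_of_hasGaussianLaw (hasGaussianLaw_apply hZ) (Sum.inl (k, i)) (Sum.inr (l, i))
    rw [integral_finsetSum _ fun i _ ↦ hi i]
    simp_rw [integral_design_mul_response hJ hZ, crossCov_eq hJ hZ hind, Matrix.mul_apply,
      Fintype.sum_prod_type]
    simp only [Matrix.kroneckerMap_apply, Matrix.one_apply, mul_ite, mul_one, mul_zero,
      Finset.sum_ite_eq', Finset.mem_univ, if_true, mul_assoc, Finset.sum_mul,
      Finset.mul_sum]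
    exact Finset.sum_comm
  rw [popCoef, hXY, ← Matrix.mul_assoc, Matrix.nonsing_inv_mul _ hM, Matrix.one_mul]

/-- The noise is a linear image of the stacked Gaussian vector. Since `CXY = CX V`, the joint
quadratic form at the pulled-back argument collapses to the Schur complement. -/
theorem charFun_noise [IsProbabilityMeasure P] (hCX : CX.PosDef)
    (hind : IndepFun (fun ω ↦ evec (X ω)) (fun ω ↦ evec (Y ω - X ω * W)) P)
    (t : EuclideanSpace ℝ (Fin H × Fin N)) :
    charFun (P.map fun ω ↦ evec (Y ω - X ω * W)) t =
      Complex.exp (-((t ⬝ᵥ resCov CX CXY CY *ᵥ t : ℝ) : ℂ) / 2) := by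
  have hcross := crossCov_eq hJ hZ hind
  set V := W ⊗ₖ (1 : Matrix (Fin N) (Fin N) ℝ) with hV
  have hCXt : CXᵀ = CX := by simpa using hCX.1.eq
  have hCXinv : CX * CX⁻¹ = 1 :=
    Matrix.mul_nonsing_inv _ ((Matrix.isUnit_iff_isUnit_det _).mp hCX.isUnit)
  have hXm := aemeasurable_design_apply hZ.aemeasurable
  have hYm := aemeasurable_response_apply hZ.aemeasurable
  -- The adjoint of `(vec X, vec Y) ↦ vec (Y - XW)` applied to `t`.
  let s : EuclideanSpace ℝ ((Fin L × Fin N) ⊕ (Fin H × Fin N)) :=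
    WithLp.toLp 2 (Sum.elim (-(V *ᵥ t)) t)
  have hEm : AEMeasurable (fun ω ↦ evec (Y ω - X ω * W)) P := by
    refine (WithLp.measurable_toLp 2 (Fin H × Fin N → ℝ)).comp_aemeasurable
      (aemeasurable_pi_lambda _ fun q ↦ ?_)
    simp only [Matrix.vec, Matrix.sub_apply, Matrix.mul_apply]
    exact (hYm _ _).sub (Finset.aemeasurable_fun_sum _ fun m _ ↦ (hXm _ m).mul_const _)
  have hinner (ω : Ω) : inner ℝ (evec (Y ω - X ω * W)) t = inner ℝ (stackVec (X ω) (Y ω)) s := by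
    have h1 : (X ω * W).vec = Vᵀ *ᵥ (X ω).vec := by
      rw [hV, ← Matrix.kroneckerMap_transpose, Matrix.transpose_one, Matrix.kronecker_mulVec_vec]
      simp
    simp only [EuclideanSpace.inner_eq_star_dotProduct, evec, stackVec, s, star_trivial,
      Matrix.vec_sub, h1]
    rw [sumElim_dotProduct_sumElim, dotProduct_sub, Matrix.dotProduct_mulVec,
      Matrix.vecMul_transpose, neg_dotProduct]
    ring
  have hquad : s ⬝ᵥ jointCov CX CXY CY *ᵥ s = t ⬝ᵥ resCov CX CXY CY *ᵥ t := by
    have h1 : CXYᵀ * CX⁻¹ * CXY = CXYᵀ * V := by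
      rw [hcross, Matrix.transpose_mul, hCXt, Matrix.mul_assoc Vᵀ, hCXinv]
      simp only [Matrix.mul_assoc, Matrix.mul_one]
    have h2 : CX *ᵥ (V *ᵥ t) = CXY *ᵥ t := by rw [hcross, Matrix.mulVec_mulVec]
    simp only [jointCov, resCov, s, Matrix.fromBlocks_mulVec, h1, sumElim_dotProduct_sumElim,
      Sum.elim_comp_inl, Sum.elim_comp_inr, Matrix.mulVec_neg, h2, Matrix.sub_mulVec,
      ← Matrix.mulVec_mulVec]
    simp [dotProduct_add, dotProduct_sub]
    ring
  rw [charFun_apply, integral_map hEm (by fun_prop)]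
  simp_rw [hinner]
  have h3 := charFun_multivariateGaussian (μ := 0) hJ s
  rw [charFun_apply, ← hZ.map_eq, integral_map hZ.aemeasurable (by fun_prop)] at h3
  rw [h3, hquad]
  simp [neg_div]

/-- The empirical second moments concentrate around their expectation. -/
theorem measureReal_le_abs_gram_sub (hN : 0 < N) (k l : Fin L) {ε : ℝ} (hε : 0 < ε) :
    P.real {ω | ε ≤ |((N : ℝ)⁻¹ • ((X ω)ᵀ * X ω)) k l - moment P X X k l|} ≤
      2 / ε ^ 2 * ((1 / (N : ℝ) ^ 2) * ∑ p, ∑ q, (CX p q) ^ 2) := by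
  have hN' : (0 : ℝ) < N := by exact_mod_cast hN
  have hG := hasGaussianLaw_apply hZ
  have : IsProbabilityMeasure P := hG.isProbabilityMeasure
  have hblock (k l : Fin L) : ∑ i, ∑ j, CX (k, i) (l, j) ^ 2 ≤ ∑ p, ∑ q, (CX p q) ^ 2 := by
    rw [Fintype.sum_prod_type]
    refine le_trans ?_ (Finset.single_le_sum (f := fun k ↦ ∑ i, ∑ q, CX (k, i) q ^ 2)
      (fun _ _ ↦ by positivity) (Finset.mem_univ k))
    refine Finset.sum_le_sum fun i _ ↦ ?_
    rw [Fintype.sum_prod_type]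
    exact Finset.single_le_sum (f := fun l ↦ ∑ j, CX (k, i) (l, j) ^ 2)
      (fun _ _ ↦ by positivity) (Finset.mem_univ l)
  have hvar : Var[fun ω ↦ ∑ i, X ω i k * X ω i l; P] ≤ 2 * ∑ p, ∑ q, (CX p q) ^ 2 := by
    have h := variance_sum_mul hG (integral_apply_eq_zero hZ)
      (fun i : Fin N ↦ Sum.inl (k, i)) (fun i ↦ Sum.inl (l, i))
    simp_rw [integral_apply_mul_apply hJ hZ] at h
    refine h.le.trans ?_
    simp only [jointCov, Matrix.fromBlocks_apply₁₁]
    -- The inequality `xy ≤ (x² + y²)/2` leaves half the squared Frobenius norms of four blocks,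
    -- each at most that of `CX`; hence the factor 2.
    calc ∑ i, ∑ j, (CX (k, i) (k, j) * CX (l, i) (l, j) + CX (k, i) (l, j) * CX (l, i) (k, j))
        ≤ ∑ i, ∑ j, (CX (k, i) (k, j) ^ 2 / 2 + CX (l, i) (l, j) ^ 2 / 2 +
          CX (k, i) (l, j) ^ 2 / 2 + CX (l, i) (k, j) ^ 2 / 2) := by
          refine Finset.sum_le_sum fun i _ ↦ Finset.sum_le_sum fun j _ ↦ ?_
          nlinarith [sq_nonneg (CX (k, i) (k, j) - CX (l, i) (l, j)),
            sq_nonneg (CX (k, i) (l, j) - CX (l, i) (k, j))]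
      _ ≤ _ := by
          simp only [Finset.sum_add_distrib, ← Finset.sum_div]
          linarith [hblock k k, hblock l l, hblock k l, hblock l k]
  have h := measure_le_abs_sum_mul_sub hG (fun i : Fin N ↦ Sum.inl (k, i)) (fun i ↦ Sum.inl (l, i))
    (mul_pos hε hN') hvar
  refine le_trans (measureReal_mono fun ω hω ↦ ?_) (h.trans (le_of_eq ?_))
  · simp only [Set.mem_ofPred_eq] at hω ⊢
    rw [moment_design_apply hZ, Matrix.smul_apply, smul_eq_mul, Matrix.mul_apply, ← one_div,
      ← mul_sub, abs_mul, abs_of_pos (by positivity : 0 < 1 / (N : ℝ)), one_div_mul_eq_div,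
      le_div_iff₀ hN'] at hω
    exact hω
  · field_simp

end Model

/-! ### Matrix identities for least squares and the limiting covariance. -/

section Algebra

theorem inner_evec_evec {m n : Type*} [Fintype m] [Fintype n] (A B : Matrix m n ℝ) :
    inner ℝ (evec A) (evec B) = (Aᵀ * B).trace := by
  rw [EuclideanSpace.inner_eq_star_dotProduct, star_trivial, dotProduct_comm, evec, evec,
    Matrix.vec_dotProduct_vec]

theorem gram_inv_transpose {N L : ℕ} (X : Matrix (Fin N) (Fin L) ℝ) :
    ((Xᵀ * X)⁻¹)ᵀ = (Xᵀ * X)⁻¹ := by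
  rw [Matrix.transpose_nonsing_inv, Matrix.transpose_mul, Matrix.transpose_transpose]

/-- True for a singular Gram matrix as well, since its inverse is then zero; this frees the
quadratic-form identities below from invertibility. -/
theorem gram_inv_mul_mul {N L : ℕ} (X : Matrix (Fin N) (Fin L) ℝ) :
    (Xᵀ * X)⁻¹ * (Xᵀ * X) * (Xᵀ * X)⁻¹ = (Xᵀ * X)⁻¹ := by
  by_cases h : IsUnit (Xᵀ * X).det
  · rw [Matrix.nonsing_inv_mul _ h, Matrix.one_mul]
  · simp [Matrix.nonsing_inv_apply_not_isUnit _ h]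

/-- The factor `(XᵀX)⁻¹(XᵀX)` is kept so that the splitting into signal and noise is valid for every
design. -/
theorem estimator_linear_model {N L H : ℕ} (X : Matrix (Fin N) (Fin L) ℝ)
    (Y : Matrix (Fin N) (Fin H) ℝ) (W : Matrix (Fin L) (Fin H) ℝ) :
    estimator X Y = (Xᵀ * X)⁻¹ * (Xᵀ * X) * W + estimator X (Y - X * W) := by
  simp only [estimator, Matrix.mul_sub, Matrix.mul_assoc]
  abel

/-- For a fixed design, a linear functional of the noise part is a linear form in `E`, ready for the
characteristic function of `E`. -/
theorem inner_evec_estimator {N L H : ℕ} (X : Matrix (Fin N) (Fin L) ℝ)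
    (E : Matrix (Fin N) (Fin H) ℝ) (B : Matrix (Fin L) (Fin H) ℝ) :
    inner ℝ (evec (estimator X E)) (evec B) = inner ℝ (evec E) (evec (X * (Xᵀ * X)⁻¹ * B)) := by
  rw [inner_evec_evec, inner_evec_evec, estimator, Matrix.transpose_mul, Matrix.transpose_mul,
    Matrix.transpose_transpose, gram_inv_transpose]
  simp only [Matrix.mul_assoc]

/-- Noise covariance `R ⊗ I` turns into estimator covariance `R ⊗ (XᵀX)⁻¹`. With `R = 1` it
evaluates the squared norm of the coefficient vector. -/
theorem dotProduct_kronecker_one_mulVec {N L H : ℕ} (X : Matrix (Fin N) (Fin L) ℝ)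
    (B : Matrix (Fin L) (Fin H) ℝ) (R : Matrix (Fin H) (Fin H) ℝ) :
    (X * (Xᵀ * X)⁻¹ * B).vec ⬝ᵥ (R ⊗ₖ (1 : Matrix (Fin N) (Fin N) ℝ)) *ᵥ (X * (Xᵀ * X)⁻¹ * B).vec =
      B.vec ⬝ᵥ (R ⊗ₖ (Xᵀ * X)⁻¹) *ᵥ B.vec := by
  rw [Matrix.kronecker_mulVec_vec, Matrix.kronecker_mulVec_vec, Matrix.vec_dotProduct_vec,
    Matrix.vec_dotProduct_vec, Matrix.transpose_mul, Matrix.transpose_mul, gram_inv_transpose]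
  have h := gram_inv_mul_mul X
  simp only [Matrix.one_mul]
  calc (Bᵀ * ((Xᵀ * X)⁻¹ * Xᵀ) * (X * (Xᵀ * X)⁻¹ * B * Rᵀ)).trace
      = (Bᵀ * ((Xᵀ * X)⁻¹ * (Xᵀ * X) * (Xᵀ * X)⁻¹) * (B * Rᵀ)).trace := by
        simp only [Matrix.mul_assoc]
    _ = _ := by rw [h]; simp only [Matrix.mul_assoc]

theorem abs_dotProduct_mulVec_le {ι : Type*} [Fintype ι] [DecidableEq ι] (A : Matrix ι ι ℝ)
    (x y : EuclideanSpace ℝ ι) :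
    |x ⬝ᵥ A *ᵥ y| ≤ ‖Matrix.toEuclideanCLM (𝕜 := ℝ) A‖ * (‖x‖ * ‖y‖) := by
  rw [← Matrix.inner_toEuclideanCLM]
  calc |inner ℝ x (Matrix.toEuclideanCLM (𝕜 := ℝ) A y)|
      ≤ ‖x‖ * ‖Matrix.toEuclideanCLM (𝕜 := ℝ) A y‖ := abs_real_inner_le_norm _ _
    _ ≤ ‖x‖ * (‖Matrix.toEuclideanCLM (𝕜 := ℝ) A‖ * ‖y‖) := by
        gcongr; exact ContinuousLinearMap.le_opNorm _ _
    _ = _ := by ring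

/-- The conditional covariance of the estimator, compared with its limiting shape. -/
theorem abs_quadratic_sub_le {N L H : ℕ} (X : Matrix (Fin N) (Fin L) ℝ)
    (B : Matrix (Fin L) (Fin H) ℝ) (R : Matrix (Fin H × Fin N) (Fin H × Fin N) ℝ)
    (R₀ : Matrix (Fin H) (Fin H) ℝ) :
    |(X * (Xᵀ * X)⁻¹ * B).vec ⬝ᵥ R *ᵥ (X * (Xᵀ * X)⁻¹ * B).vec -
        B.vec ⬝ᵥ (R₀ ⊗ₖ (Xᵀ * X)⁻¹) *ᵥ B.vec| ≤
      ‖Matrix.toEuclideanCLM (𝕜 := ℝ) (R - R₀ ⊗ₖ (1 : Matrix (Fin N) (Fin N) ℝ))‖ *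
        (B.vec ⬝ᵥ ((1 : Matrix (Fin H) (Fin H) ℝ) ⊗ₖ (Xᵀ * X)⁻¹) *ᵥ B.vec) := by
  have h := abs_dotProduct_mulVec_le (R - R₀ ⊗ₖ (1 : Matrix (Fin N) (Fin N) ℝ))
    (evec (X * (Xᵀ * X)⁻¹ * B)) (evec (X * (Xᵀ * X)⁻¹ * B))
  rw [← real_inner_self_eq_norm_mul_norm, EuclideanSpace.inner_eq_star_dotProduct, star_trivial,
    Matrix.sub_mulVec, dotProduct_sub] at h
  simp only [evec] at h
  rw [dotProduct_kronecker_one_mulVec] at h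
  have h1 := dotProduct_kronecker_one_mulVec X B 1
  rw [Matrix.one_kronecker_one, Matrix.one_mulVec] at h1
  rwa [h1] at h

theorem continuousAt_quadratic_inv {L H : ℕ} (R : Matrix (Fin H) (Fin H) ℝ)
    (b : Fin H × Fin L → ℝ) {S : Matrix (Fin L) (Fin L) ℝ} (hS : S.det ≠ 0) :
    ContinuousAt (fun M : Matrix (Fin L) (Fin L) ℝ ↦ b ⬝ᵥ (R ⊗ₖ M⁻¹) *ᵥ b) S := by
  have h1 : ContinuousAt (Inv.inv : Matrix (Fin L) (Fin L) ℝ → _) S :=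
    continuousAt_matrix_inv S (by rw [Ring.inverse_eq_inv']; exact continuousAt_inv₀ hS)
  have h2 : Continuous fun G : Matrix (Fin L) (Fin L) ℝ ↦ b ⬝ᵥ (R ⊗ₖ G) *ᵥ b := by
    refine Continuous.dotProduct continuous_const (Continuous.matrix_mulVec ?_ continuous_const)
    exact continuous_matrix fun i j ↦ continuous_const.mul (continuous_id.matrix_elem _ _)
  exact h2.continuousAt.comp h1

/-- The limit in operator norm of positive semidefinite matrices of the form `R₀ ⊗ I`. -/
theorem posSemidef_of_tendsto_kronecker {H : ℕ}
    {R : ∀ N, Matrix (Fin H × Fin N) (Fin H × Fin N) ℝ} {R₀ : Matrix (Fin H) (Fin H) ℝ}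
    (hR : ∀ N, (R N).PosSemidef)
    (h : Tendsto (fun N ↦ ‖Matrix.toEuclideanCLM (𝕜 := ℝ)
      (R N - R₀ ⊗ₖ (1 : Matrix (Fin N) (Fin N) ℝ))‖) atTop (𝓝 0)) : R₀.PosSemidef := by
  -- The block at row index 0, where `R₀ ⊗ I` has entries `R₀ i j`; the shift to `N + 1` guarantees
  -- that this index exists.
  let Q : ℕ → Matrix (Fin H) (Fin H) ℝ := fun N ↦ (R (N + 1)).submatrix (·, 0) (·, 0)
  have hQ (N : ℕ) : (Q N).PosSemidef := (hR (N + 1)).submatrix _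
  have hlim (i j : Fin H) : Tendsto (fun N ↦ Q N i j) atTop (𝓝 (R₀ i j)) := by
    rw [tendsto_iff_norm_sub_tendsto_zero]
    refine squeeze_zero (fun _ ↦ norm_nonneg _) (fun N ↦ ?_) ((tendsto_add_atTop_iff_nat 1).mpr h)
    have := abs_dotProduct_mulVec_le (R (N + 1) - R₀ ⊗ₖ (1 : Matrix (Fin (N + 1)) (Fin (N + 1)) ℝ))
      (EuclideanSpace.single (i, 0) 1) (EuclideanSpace.single (j, 0) 1)
    simpa [Q] using this
  have hRt : Tendsto Q atTop (𝓝 R₀) := tendsto_pi_nhds.mpr fun i ↦ tendsto_pi_nhds.mpr (hlim i)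
  refine Matrix.PosSemidef.of_dotProduct_mulVec_nonneg ?_ fun x ↦ ?_
  · ext i j
    refine tendsto_nhds_unique ((hlim j i).congr fun N ↦ ?_) (hlim i j)
    exact (hQ N).1.apply i j
  · have hc : Continuous fun A : Matrix (Fin H) (Fin H) ℝ ↦ star x ⬝ᵥ A *ᵥ x :=
      Continuous.dotProduct continuous_const (continuous_id.matrix_mulVec continuous_const)
    exact ge_of_tendsto' ((hc.tendsto R₀).comp hRt) fun N ↦ (hQ N).dotProduct_mulVec_nonneg x

theorem resCov_posSemidef {N L H : ℕ} {CX : Matrix (Fin L × Fin N) (Fin L × Fin N) ℝ}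
    {CXY : Matrix (Fin L × Fin N) (Fin H × Fin N) ℝ}
    {CY : Matrix (Fin H × Fin N) (Fin H × Fin N) ℝ}
    (hJ : (jointCov CX CXY CY).PosSemidef) (hCX : CX.PosDef) : (resCov CX CXY CY).PosSemidef := by
  have := hCX.isUnit.invertible
  have h := (Matrix.PosDef.fromBlocks₁₁ CXY CY hCX).mp
  simp only [Matrix.conjTranspose_eq_transpose_of_trivial] at h
  exact h hJ

end Algebra

/-! ### Conditioning on the design, and the limit theorem. -/

section Model

variable {Ω : Type*} [MeasurableSpace Ω] {P : Measure Ω} {N L H : ℕ}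
  {X : Ω → Matrix (Fin N) (Fin L) ℝ} {Y : Ω → Matrix (Fin N) (Fin H) ℝ}
  {CX : Matrix (Fin L × Fin N) (Fin L × Fin N) ℝ}
  {CXY : Matrix (Fin L × Fin N) (Fin H × Fin N) ℝ}
  {CY : Matrix (Fin H × Fin N) (Fin H × Fin N) ℝ} {W : Matrix (Fin L) (Fin H) ℝ}

theorem aemeasurable_scaled_estimator (hZ : AEMeasurable (fun ω ↦ stackVec (X ω) (Y ω)) P)
    (c : ℝ) (w : EuclideanSpace ℝ (Fin H × Fin L)) :
    AEMeasurable (fun ω ↦ c • (evec (estimator (X ω) (Y ω)) - w)) P := by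
  have h : Measurable fun z : EuclideanSpace ℝ ((Fin L × Fin N) ⊕ (Fin H × Fin N)) ↦
      evec (estimator (Matrix.of fun i k ↦ z (Sum.inl (k, i)))
        (Matrix.of fun i k ↦ z (Sum.inr (k, i)))) :=
    measurable_evec (measurable_estimator_apply (fun i k ↦ by simp only [Matrix.of_apply]; fun_prop)
      fun i k ↦ by simp only [Matrix.of_apply]; fun_prop)
  exact ((h.comp_aemeasurable hZ).sub_const w).const_smul c

/-- The characteristic function of the rescaled estimation error, by conditioning on the design. -/
theorem charFun_scaled_estimator [IsProbabilityMeasure P]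
    (hJ : (jointCov CX CXY CY).PosSemidef) (hCX : CX.PosDef)
    (hZ : HasLaw (fun ω ↦ stackVec (X ω) (Y ω)) (multivariateGaussian 0 (jointCov CX CXY CY)) P)
    (hind : IndepFun (fun ω ↦ evec (X ω)) (fun ω ↦ evec (Y ω - X ω * W)) P)
    (B : Matrix (Fin L) (Fin H) ℝ) :
    ∃ f : Matrix (Fin N) (Fin L) ℝ → ℂ, AEStronglyMeasurable (fun ω ↦ f (X ω)) P ∧
      (∀ A, ‖f A‖ ≤ 1) ∧
      charFun (P.map fun ω ↦ √(N : ℝ) • (evec (estimator (X ω) (Y ω)) - evec W)) (evec B) =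
        ∫ ω, f (X ω) ∂P ∧
      ∀ A : Matrix (Fin N) (Fin L) ℝ, IsUnit (Aᵀ * A).det →
        f A = Complex.exp (-(((N : ℝ) * ((A * (Aᵀ * A)⁻¹ * B).vec ⬝ᵥ
          resCov CX CXY CY *ᵥ (A * (Aᵀ * A)⁻¹ * B).vec) : ℝ) : ℂ) / 2) := by
  have hXm := aemeasurable_design_apply hZ.aemeasurable
  have hYm := aemeasurable_response_apply hZ.aemeasurable
  have hxm : AEMeasurable (fun ω ↦ evec (X ω)) P :=
    (WithLp.measurable_toLp 2 (Fin L × Fin N → ℝ)).comp_aemeasurable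
      (aemeasurable_pi_lambda _ fun q ↦ hXm q.2 q.1)
  have hem : AEMeasurable (fun ω ↦ evec (Y ω - X ω * W)) P := by
    refine (WithLp.measurable_toLp 2 (Fin H × Fin N → ℝ)).comp_aemeasurable
      (aemeasurable_pi_lambda _ fun q ↦ ?_)
    simp only [Matrix.vec, Matrix.sub_apply, Matrix.mul_apply]
    exact (hYm _ _).sub (Finset.aemeasurable_fun_sum _ fun m _ ↦ (hXm _ m).mul_const _)
  -- Given the design, the phase is `h` plus the pairing of `E` with `g`. The offset `h` is nonzero
  -- only for a singular Gram matrix.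
  let g : Matrix (Fin N) (Fin L) ℝ → EuclideanSpace ℝ (Fin H × Fin N) := fun A ↦
    √(N : ℝ) • evec (A * (Aᵀ * A)⁻¹ * B)
  let h : Matrix (Fin N) (Fin L) ℝ → ℝ := fun A ↦
    √(N : ℝ) * inner ℝ (evec ((Aᵀ * A)⁻¹ * (Aᵀ * A) * W - W)) (evec B)
  let f : Matrix (Fin N) (Fin L) ℝ → ℂ := fun A ↦ Complex.exp (h A * Complex.I) *
    charFun (P.map fun ω ↦ evec (Y ω - X ω * W)) (g A)
  let T : EuclideanSpace ℝ (Fin L × Fin N) → Matrix (Fin N) (Fin L) ℝ := fun x ↦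
    Matrix.of fun i k ↦ x (k, i)
  have hT (i k) : Measurable fun x ↦ T x i k := by simp only [T, Matrix.of_apply]; fun_prop
  have hG (i k) : Measurable fun x ↦ ((T x)ᵀ * T x) i k :=
    measurable_matrix_mul_apply (fun i j ↦ hT j i) hT i k
  have hgm : Measurable fun x ↦ g (T x) :=
    (measurable_evec (measurable_matrix_mul_apply (g := fun _ ↦ B) (measurable_matrix_mul_apply hT
      (measurable_matrix_inv_apply hG)) fun _ _ ↦ measurable_const)).const_smul (√(N : ℝ))
  have hhm : Measurable fun x ↦ h (T x) := by
    refine ((measurable_evec fun i j ↦ ?_).inner measurable_const).const_mul _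
    simp only [Matrix.sub_apply]
    exact (measurable_matrix_mul_apply (measurable_matrix_mul_apply
      (measurable_matrix_inv_apply hG) hG) (g := fun _ ↦ W) (fun _ _ ↦ measurable_const) i j).sub_const _
  have : IsProbabilityMeasure (P.map fun ω ↦ evec (Y ω - X ω * W)) :=
    Measure.isProbabilityMeasure_map hem
  have hcm : Measurable (charFun (P.map fun ω ↦ evec (Y ω - X ω * W))) := by fun_prop
  have hfm : Measurable fun x ↦ f (T x) :=
    (Complex.measurable_exp.comp ((Complex.measurable_ofReal.comp hhm).mul_const Complex.I)).mul
      (hcm.comp hgm)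
  refine ⟨f, (hfm.comp_aemeasurable hxm).aestronglyMeasurable, fun A ↦ ?_, ?_, fun A hA ↦ ?_⟩
  · simp only [f, norm_mul, Complex.norm_exp_ofReal_mul_I, one_mul]
    exact norm_charFun_le_one _
  · rw [charFun_apply, integral_map (aemeasurable_scaled_estimator hZ.aemeasurable _ _)
      (by fun_prop)]
    have hk := integral_exp_inner_of_indepFun hxm hem hind hhm hgm
    refine Eq.trans (integral_congr_ae (ae_of_all _ fun ω ↦ ?_)) hk
    have hTX : T (evec (X ω)) = X ω := rfl
    simp only [hTX, h, g]
    congr 3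
    have hsplit : evec (estimator (X ω) (Y ω)) - evec W =
        evec (((X ω)ᵀ * X ω)⁻¹ * ((X ω)ᵀ * X ω) * W - W) +
          evec (estimator (X ω) (Y ω - X ω * W)) := by
      rw [estimator_linear_model _ _ W]
      simp only [evec, Matrix.vec_add, Matrix.vec_sub, WithLp.toLp_add, WithLp.toLp_sub]
      abel
    rw [hsplit, real_inner_smul_left, inner_add_left, inner_evec_estimator, real_inner_smul_right,
      mul_add]
  · simp only [f]
    have hh : h A = 0 := by
      simp [h, Matrix.nonsing_inv_mul _ hA, evec]
    rw [hh, charFun_noise hJ hZ hCX hind]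
    simp only [g, evec, WithLp.ofLp_smul, Matrix.mulVec_smul, smul_dotProduct, dotProduct_smul,
      smul_eq_mul, ← mul_assoc, Real.mul_self_sqrt (Nat.cast_nonneg N)]
    simp

end Model

/-- Asymptotic normality of the least-squares estimator for Gaussian designs. -/
theorem tendstoInDistribution_estimator {L H : ℕ} {Ω : ℕ → Type*} [∀ N, MeasurableSpace (Ω N)]
    {P : ∀ N, Measure (Ω N)} [∀ N, IsProbabilityMeasure (P N)]
    {X : ∀ N, Ω N → Matrix (Fin N) (Fin L) ℝ} {Y : ∀ N, Ω N → Matrix (Fin N) (Fin H) ℝ}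
    {CX : ∀ N, Matrix (Fin L × Fin N) (Fin L × Fin N) ℝ}
    {CXY : ∀ N, Matrix (Fin L × Fin N) (Fin H × Fin N) ℝ}
    {CY : ∀ N, Matrix (Fin H × Fin N) (Fin H × Fin N) ℝ}
    {W : ℕ → Matrix (Fin L) (Fin H) ℝ}
    {S : Matrix (Fin L) (Fin L) ℝ} {R₀ : Matrix (Fin H) (Fin H) ℝ}
    (hJ : ∀ N, (jointCov (CX N) (CXY N) (CY N)).PosSemidef) (hCX : ∀ N, (CX N).PosDef)
    (hZ : ∀ N, HasLaw (fun ω ↦ stackVec (X N ω) (Y N ω))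
      (multivariateGaussian 0 (jointCov (CX N) (CXY N) (CY N))) (P N))
    (hind : ∀ N, IndepFun (fun ω ↦ evec (X N ω)) (fun ω ↦ evec (Y N ω - X N ω * W N)) (P N))
    (hres : Tendsto (fun N ↦ ‖Matrix.toEuclideanCLM (𝕜 := ℝ)
      (resCov (CX N) (CXY N) (CY N) - R₀ ⊗ₖ (1 : Matrix (Fin N) (Fin N) ℝ))‖) atTop (𝓝 0))
    (hmom : Tendsto (fun N ↦ moment (P N) (X N) (X N)) atTop (𝓝 S)) (hS : S.PosDef)
    (hCX2 : Tendsto (fun N : ℕ ↦ (1 / (N : ℝ) ^ 2) * ∑ p, ∑ q, (CX N p q) ^ 2) atTop (𝓝 0)) :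
    TendstoInDistribution
      (fun (N : ℕ) (ω : Ω N) ↦ √(N : ℝ) •
        (evec (estimator (X N ω) (Y N ω)) - evec (popCoef (P N) (X N) (Y N))))
      atTop id P (multivariateGaussian 0 (R₀ ⊗ₖ S⁻¹)) := by
  have hmeas (N : ℕ) := aemeasurable_scaled_estimator (hZ N).aemeasurable (√(N : ℝ))
    (evec (popCoef (P N) (X N) (Y N)))
  refine ⟨hmeas, aemeasurable_id, ?_⟩
  refine ProbabilityMeasure.tendsto_iff_tendsto_charFun.2 fun t ↦ ?_
  obtain ⟨B, rfl⟩ : ∃ B : Matrix (Fin L) (Fin H) ℝ, t = evec B :=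
    ⟨Matrix.of fun i j ↦ t (j, i), rfl⟩
  have hR₀ : R₀.PosSemidef :=
    posSemidef_of_tendsto_kronecker (fun N ↦ resCov_posSemidef (hJ N) (hCX N)) hres
  have hSdet : S.det ≠ 0 := hS.det_pos.ne'
  choose f hfm hf1 hfchar hfexp using fun N ↦
    charFun_scaled_estimator (hJ N) (hCX N) (hZ N) (hind N) B
  set M : ∀ N, Ω N → Matrix (Fin L) (Fin L) ℝ := fun N ω ↦ (N : ℝ)⁻¹ • ((X N ω)ᵀ * X N ω) with hM
  set F : Matrix (Fin L) (Fin L) ℝ → ℝ := fun A ↦ B.vec ⬝ᵥ (R₀ ⊗ₖ A⁻¹) *ᵥ B.vec with hF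
  set K : Matrix (Fin L) (Fin L) ℝ → ℝ := fun A ↦
    B.vec ⬝ᵥ ((1 : Matrix (Fin H) (Fin H) ℝ) ⊗ₖ A⁻¹) *ᵥ B.vec with hK
  have hFnonneg : 0 ≤ F S := by
    simpa using (hR₀.kronecker hS.inv.posSemidef).dotProduct_mulVec_nonneg B.vec
  set c : ℂ := Complex.exp (-((F S : ℝ) : ℂ) / 2) with hc
  have hdet : ∀ᶠ A in 𝓝 S, A.det ≠ 0 :=
    (continuous_id.matrix_det.tendsto S).eventually_ne hSdet
  have hconv {U : Set (Matrix (Fin L) (Fin L) ℝ)} (hU : U ∈ 𝓝 S) :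
      Tendsto (fun N ↦ (P N).real {ω | M N ω ∉ U}) atTop (𝓝 0) := by
    refine tendsto_measureReal_notMem_nhds hmom (fun k l ε hε ↦ ?_) hU
    refine squeeze_zero' (Eventually.of_forall fun N ↦ measureReal_nonneg)
      ((eventually_gt_atTop 0).mono fun N hN ↦
        measureReal_le_abs_gram_sub (hJ N) (hZ N) hN k l hε) ?_
    simpa using hCX2.const_mul (2 / ε ^ 2)
  have hlim : Tendsto (fun N ↦ ∫ ω, f N (X N ω) ∂P N) atTop (𝓝 c) := by
    refine tendsto_integral_of_tendsto_measureReal hfm (fun N ω ↦ hf1 N _) ?_ fun ε hε ↦ ?_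
    · rw [hc, Complex.norm_exp]
      norm_cast
      rw [Real.exp_le_one_iff]
      linarith
    have hexp : Tendsto (fun q : ℝ ↦ Complex.exp (-(q : ℂ) / 2)) (𝓝 (F S)) (𝓝 c) :=
      Continuous.tendsto (by fun_prop) _
    obtain ⟨η, hη, hηc⟩ := Metric.tendsto_nhds_nhds.mp hexp ε hε
    -- Two errors in the exponent: replacing the residual covariance by `R₀ ⊗ I`, weighted by `K`,
    -- and replacing the empirical Gram matrix by `S`. Both vanish jointly as `N` grows and the
    -- matrix approaches `S`.
    have hbound : Tendsto (fun p : ℕ × Matrix (Fin L) (Fin L) ℝ ↦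
        ‖Matrix.toEuclideanCLM (𝕜 := ℝ) (resCov (CX p.1) (CXY p.1) (CY p.1) -
          R₀ ⊗ₖ (1 : Matrix (Fin p.1) (Fin p.1) ℝ))‖ * K p.2 + |F p.2 - F S|)
        (atTop ×ˢ 𝓝 S) (𝓝 0) := by
      have hKc : Tendsto K (𝓝 S) (𝓝 (K S)) := continuousAt_quadratic_inv 1 B.vec hSdet
      have hFc : Tendsto F (𝓝 S) (𝓝 (F S)) := continuousAt_quadratic_inv R₀ B.vec hSdet
      simpa using ((hres.comp tendsto_fst).mul (hKc.comp tendsto_snd)).add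
        (((hFc.comp tendsto_snd).sub_const (F S)).abs)
    obtain ⟨p, hp, q, hq, hpq⟩ := eventually_prod_iff.mp (hbound.eventually_lt_const hη)
    refine squeeze_zero' (Eventually.of_forall fun N ↦ measureReal_nonneg) ?_
      (hconv (hq.and hdet))
    filter_upwards [hp, eventually_gt_atTop 0] with N hpN hN
    refine measureReal_mono fun ω hω hMω ↦ ?_
    obtain ⟨hqM, hdetM⟩ := hMω
    refine absurd (show ε ≤ ‖f N (X N ω) - c‖ from hω) (not_le.mpr ?_)
    have hN' : (N : ℝ) ≠ 0 := by exact_mod_cast hN.ne'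
    have hU : IsUnit ((X N ω)ᵀ * X N ω).det := by
      rw [isUnit_iff_ne_zero]
      intro h0
      simp [M, h0] at hdetM
    have hinv : (M N ω)⁻¹ = (N : ℝ) • ((X N ω)ᵀ * X N ω)⁻¹ := by
      have := invertibleOfNonzero (inv_ne_zero hN')
      simp only [M]
      rw [Matrix.inv_smul _ _ hU]
      simp
    have hscale (R : Matrix (Fin H) (Fin H) ℝ) : B.vec ⬝ᵥ (R ⊗ₖ (M N ω)⁻¹) *ᵥ B.vec =
        N * (B.vec ⬝ᵥ (R ⊗ₖ ((X N ω)ᵀ * X N ω)⁻¹) *ᵥ B.vec) := by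
      rw [hinv, Matrix.kronecker_smul, Matrix.smul_mulVec, dotProduct_smul, smul_eq_mul]
    have hquad := abs_quadratic_sub_le (X N ω) B (resCov (CX N) (CXY N) (CY N)) R₀
    have hpq' := hpq hpN hqM
    rw [hfexp N _ hU, ← dist_eq_norm]
    refine hηc ?_
    rw [Real.dist_eq]
    refine (abs_sub_le _ (F (M N ω)) _).trans_lt (lt_of_le_of_lt ?_ hpq')
    gcongr
    simp only [F, K, hscale]
    rw [← mul_sub, abs_mul, Nat.abs_cast, mul_left_comm]
    gcongr
  have hpop : ∀ᶠ N in atTop, popCoef (P N) (X N) (Y N) = W N := by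
    filter_upwards [hmom.eventually hdet] with N hN
    exact popCoef_eq (hJ N) (hZ N) (hind N) (isUnit_iff_ne_zero.mpr hN)
  have hcharlim : charFun (multivariateGaussian 0 (R₀ ⊗ₖ S⁻¹)) (evec B) = c := by
    rw [charFun_multivariateGaussian (hR₀.kronecker hS.inv.posSemidef), hc]
    simp [evec, hF, neg_div]
  simp only [ProbabilityMeasure.coe_mk, Measure.map_id, hcharlim]
  refine hlim.congr' ?_
  filter_upwards [hpop] with N hN
  rw [hN, hfchar]

/-! ### Second moments and concentration for white noise. -/

section WhiteNoise

variable {Ω : Type*} [MeasurableSpace Ω] {P : Measure Ω} {ε : ℕ → Ω → ℝ} {v : ℝ≥0}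

theorem hasGaussianLaw_whiteNoise (hε : ∀ t, HasLaw (ε t) (gaussianReal 0 v) P)
    (hind : iIndepFun ε P) (K : ℕ) : HasGaussianLaw (fun ω (i : Fin K) ↦ ε i ω) P :=
  (hind.precomp (g := fun i : Fin K ↦ (i : ℕ)) Fin.val_injective).hasGaussianLaw
    fun i ↦ (hε i).hasGaussianLaw

theorem integral_whiteNoise (hε : ∀ t, HasLaw (ε t) (gaussianReal 0 v) P) (t : ℕ) :
    ∫ ω, ε t ω ∂P = 0 := by
  rw [(hε t).integral_eq, integral_id_gaussianReal]

theorem integrable_whiteNoise_mul (hε : ∀ t, HasLaw (ε t) (gaussianReal 0 v) P) (a b : ℕ) :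
    Integrable (fun ω ↦ ε a ω * ε b ω) P :=
  (hε a).hasGaussianLaw.memLp_two.integrable_mul (hε b).hasGaussianLaw.memLp_two

theorem integral_whiteNoise_mul (hε : ∀ t, HasLaw (ε t) (gaussianReal 0 v) P)
    (hind : iIndepFun ε P) (a b : ℕ) :
    ∫ ω, ε a ω * ε b ω ∂P = if a = b then (v : ℝ) else 0 := by
  split_ifs with h
  · subst h
    have h1 := variance_of_integral_eq_zero (hε a).aemeasurable (integral_whiteNoise hε a)
    rw [(hε a).variance_eq, variance_id_gaussianReal] at h1
    simp_rw [← sq]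
    exact h1.symm
  · rw [(hind.indepFun h).integral_fun_mul_eq_mul_integral
      (hε a).aemeasurable.aestronglyMeasurable (hε b).aemeasurable.aestronglyMeasurable,
      integral_whiteNoise hε, zero_mul]

/-- Chebyshev's inequality for sums of products of white noise. -/
theorem measureReal_le_abs_sum_whiteNoise (hε : ∀ t, HasLaw (ε t) (gaussianReal 0 v) P)
    (hind : iIndepFun ε P) {n : ℕ} {p q : Fin n → ℕ} (hp : p.Injective) (hq : q.Injective)
    {c : ℝ} (hc : 0 < c) :
    P.real {ω | c ≤ |(∑ i, ε (p i) ω * ε (q i) ω) - ∑ i, if p i = q i then (v : ℝ) else 0|} ≤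
      2 * (v : ℝ) ^ 2 * n / c ^ 2 := by
  -- Only finitely many times occur, so the Gaussian vector may be truncated at `K`.
  obtain ⟨K, hpK, hqK⟩ : ∃ K, (∀ i, p i < K) ∧ ∀ i, q i < K := by
    refine ⟨(∑ i, p i) + (∑ i, q i) + 1, fun i ↦ ?_, fun i ↦ ?_⟩
    · have := Finset.single_le_sum (f := p) (fun _ _ ↦ Nat.zero_le _) (Finset.mem_univ i)
      omega
    · have := Finset.single_le_sum (f := q) (fun _ _ ↦ Nat.zero_le _) (Finset.mem_univ i)
      omega
  have hG := hasGaussianLaw_whiteNoise hε hind K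
  have hvar := variance_sum_mul hG (fun i ↦ integral_whiteNoise hε i) (fun i ↦ ⟨p i, hpK i⟩)
    (fun i ↦ (⟨q i, hqK i⟩ : Fin K))
  simp only [integral_whiteNoise_mul hε hind] at hvar
  -- By injectivity each `i` matches at most one `j`, so each of the two Isserlis pairings
  -- contributes at most `v²` per `i`.
  have hone (f g : Fin n → ℕ) (hg : g.Injective) (i : Fin n) :
      ∑ j, (if f i = g j then (v : ℝ) ^ 2 else 0) ≤ (v : ℝ) ^ 2 := by
    rw [← Finset.sum_filter, Finset.sum_const, nsmul_eq_mul]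
    have : (Finset.univ.filter fun j ↦ f i = g j).card ≤ 1 := by
      rw [Finset.card_le_one]
      intro a ha b hb
      simp only [Finset.mem_filter, Finset.mem_univ, true_and] at ha hb
      exact hg (ha.symm.trans hb)
    have : (((Finset.univ.filter fun j ↦ f i = g j).card : ℕ) : ℝ) ≤ 1 := by exact_mod_cast this
    nlinarith [sq_nonneg (v : ℝ)]
  have hB : Var[fun ω ↦ ∑ i, ε (p i) ω * ε (q i) ω; P] ≤ 2 * (v : ℝ) ^ 2 * n := by
    refine hvar.le.trans ?_
    calc _ ≤ ∑ i, ∑ j, ((if p i = p j then (v : ℝ) ^ 2 else 0) +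
            if p i = q j then (v : ℝ) ^ 2 else 0) := by
          refine Finset.sum_le_sum fun i _ ↦ Finset.sum_le_sum fun j _ ↦ ?_
          have := sq_nonneg (v : ℝ)
          gcongr ?_ + ?_
          · split_ifs <;> nlinarith
          · split_ifs <;> nlinarith
      _ ≤ ∑ i : Fin n, ((v : ℝ) ^ 2 + (v : ℝ) ^ 2) := by
          refine Finset.sum_le_sum fun i _ ↦ ?_
          rw [Finset.sum_add_distrib]
          exact add_le_add (hone p p hp i) (hone p q hq i)
      _ = 2 * (v : ℝ) ^ 2 * n := by simp; ring
  have h := measure_le_abs_sum_mul_sub hG (fun i ↦ ⟨p i, hpK i⟩) (fun i ↦ (⟨q i, hqK i⟩ : Fin K))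
    hc hB
  simpa only [integral_whiteNoise_mul hε hind] using h

end WhiteNoise

/-! ### Anti-concentration of Gaussian linear forms. -/

section AntiConcentration

theorem gaussianReal_Icc_le (v : ℝ≥0) (hv : v ≠ 0) (a b : ℝ) :
    gaussianReal 0 v (Set.Icc a b) ≤ ENNReal.ofReal ((b - a) / √(2 * Real.pi * v)) := by
  rw [gaussianReal_apply 0 hv]
  have hpos : 0 < √(2 * Real.pi * v) := by positivity
  calc ∫⁻ x in Set.Icc a b, gaussianPDF 0 v x
      ≤ ∫⁻ x in Set.Icc a b, ENNReal.ofReal (1 / √(2 * Real.pi * v)) := by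
        refine lintegral_mono fun x ↦ ENNReal.ofReal_le_ofReal ?_
        rw [gaussianPDFReal, one_div]
        refine mul_le_of_le_one_right (by positivity) (Real.exp_le_one_iff.mpr ?_)
        rw [neg_div]
        exact neg_nonpos.mpr (by positivity)
    _ = ENNReal.ofReal ((b - a) / √(2 * Real.pi * v)) := by
        rw [lintegral_const, Measure.restrict_apply_univ, Real.volume_Icc,
          ← ENNReal.ofReal_mul (by positivity)]
        congr 1
        ring

variable {Ω E : Type*} [MeasurableSpace Ω] [MeasurableSpace E] {P : Measure Ω}
  [IsProbabilityMeasure P] {m : ℕ} {v : ℝ≥0}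

theorem map_sum_mul_of_iIndepFun {g : Fin m → Ω → ℝ}
    (hg : ∀ i, HasLaw (g i) (gaussianReal 0 v) P) (hind : iIndepFun g P) (a : Fin m → ℝ) :
    P.map (fun ω ↦ ∑ i, a i * g i ω) = gaussianReal 0 ((∑ i, a i ^ 2) * v).toNNReal := by
  have hG : HasGaussianLaw (fun ω ↦ ∑ i, a i * g i ω) P := by
    have := (hind.hasGaussianLaw fun i ↦ (hg i).hasGaussianLaw).map_fun
      (∑ i, a i • ContinuousLinearMap.proj (R := ℝ) (φ := fun _ : Fin m ↦ ℝ) i)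
    simpa [sum_apply] using this
  have hi (i : Fin m) : Integrable (g i) P := (hg i).hasGaussianLaw.integrable
  have hi2 (i : Fin m) : MemLp (g i) 2 P := (hg i).hasGaussianLaw.memLp_two
  rw [hG.map_eq_gaussianReal]
  congr 2
  · rw [integral_finsetSum _ fun i _ ↦ (hi i).const_mul _]
    simp [integral_const_mul, (hg _).integral_eq]
  · rw [variance_fun_sum fun i ↦ (hi2 i).const_mul _, Finset.sum_mul]
    refine Finset.sum_congr rfl fun i _ ↦ ?_
    rw [Finset.sum_eq_single i]
    · rw [covariance_const_mul_left, covariance_const_mul_right,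
        covariance_self (hg i).aemeasurable, (hg i).variance_eq, variance_id_gaussianReal]
      ring
    · intro j _ hj
      rw [covariance_const_mul_left, covariance_const_mul_right,
        (hind.indepFun hj.symm).covariance_eq_zero (hi2 i) (hi2 j)]
      simp
    · simp

/-- A linear form in Gaussian white noise whose random coefficients and offset are independent of
the noise does not concentrate when the coefficients are large. -/
theorem measureReal_abs_sum_le {x : Ω → E} {g : Fin m → Ω → ℝ} (hv : v ≠ 0)
    (hx : AEMeasurable x P) (hg : ∀ i, HasLaw (g i) (gaussianReal 0 v) P) (hind : iIndepFun g P)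
    (hxg : IndepFun x (fun ω i ↦ g i ω) P) {a : E → Fin m → ℝ} (ha : ∀ i, Measurable fun z ↦ a z i)
    {b : E → ℝ} (hb : Measurable b) {κ s : ℝ} (hκ : 0 < κ) (hs : 0 ≤ s) :
    P.real {ω | |(∑ i, a (x ω) i * g i ω) + b (x ω)| ≤ s} ≤
      P.real {ω | ∑ i, a (x ω) i ^ 2 < κ} + 2 * s / √(2 * Real.pi * (κ * v)) := by
  have hgm : AEMeasurable (fun ω i ↦ g i ω) P := aemeasurable_pi_lambda _ fun i ↦ (hg i).aemeasurable
  have hprod := (indepFun_iff_map_prod_eq_prod_map_map hx hgm).mp hxg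
  have : IsProbabilityMeasure (P.map x) := Measure.isProbabilityMeasure_map hx
  have : IsProbabilityMeasure (P.map fun ω i ↦ g i ω) := Measure.isProbabilityMeasure_map hgm
  set C : ENNReal := ENNReal.ofReal (2 * s / √(2 * Real.pi * (κ * v))) with hC
  have hA : MeasurableSet {z : E × (Fin m → ℝ) | |(∑ i, a z.1 i * z.2 i) + b z.1| ≤ s} := by
    refine measurableSet_le ?_ measurable_const
    have : Measurable fun z : E × (Fin m → ℝ) ↦ (∑ i, a z.1 i * z.2 i) + b z.1 :=
      (Finset.measurable_sum _ fun i _ ↦ ((ha i).comp measurable_fst).mul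
        ((measurable_pi_apply i).comp measurable_snd)).add (hb.comp measurable_fst)
    exact this.abs
  have hD : MeasurableSet {z : E | ∑ i, a z i ^ 2 < κ} :=
    measurableSet_lt (Finset.measurable_sum _ fun i _ ↦ (ha i).pow_const 2) measurable_const
  -- For a frozen `z` with large coefficients the form is Gaussian of variance at least `κ v`, and
  -- the offset merely translates an interval of length `2 s`. Small coefficients are charged to the
  -- indicator.
  have hslice (z : E) : (P.map fun ω i ↦ g i ω) {y | |(∑ i, a z i * y i) + b z| ≤ s} ≤
      {z : E | ∑ i, a z i ^ 2 < κ}.indicator 1 z + C := by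
    by_cases hz : ∑ i, a z i ^ 2 < κ
    · rw [Set.indicator_of_mem (by exact hz)]
      exact prob_le_one.trans (by simp)
    · rw [Set.indicator_of_notMem (by exact hz), zero_add]
      rw [not_lt] at hz
      have hv' : (0 : ℝ) < v := by positivity
      have hpos : 0 < (∑ i, a z i ^ 2) * v := mul_pos (hκ.trans_le hz) hv'
      have hset : {y : Fin m → ℝ | |(∑ i, a z i * y i) + b z| ≤ s} =
          (fun y ↦ ∑ i, a z i * y i) ⁻¹' Set.Icc (-s - b z) (s - b z) := by
        ext y
        simp only [Set.mem_ofPred_eq, Set.mem_preimage, Set.mem_Icc, abs_le]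
        constructor <;> rintro ⟨h1, h2⟩ <;> constructor <;> linarith
      have hlin : Measurable fun y : Fin m → ℝ ↦ ∑ i, a z i * y i := by fun_prop
      rw [hset, ← Measure.map_apply hlin measurableSet_Icc,
        AEMeasurable.map_map_of_aemeasurable hlin.aemeasurable hgm]
      change (P.map fun ω ↦ ∑ i, a z i * g i ω) _ ≤ _
      rw [map_sum_mul_of_iIndepFun hg hind (a z)]
      refine (gaussianReal_Icc_le _ (by simpa using hpos) _ _).trans ?_
      refine ENNReal.ofReal_le_ofReal ?_
      rw [Real.coe_toNNReal _ hpos.le]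
      have : s - b z - (-s - b z) = 2 * s := by ring
      rw [this]
      gcongr
  have hmain : P {ω | |(∑ i, a (x ω) i * g i ω) + b (x ω)| ≤ s} ≤
      P {ω | ∑ i, a (x ω) i ^ 2 < κ} + C := by
    calc P {ω | |(∑ i, a (x ω) i * g i ω) + b (x ω)| ≤ s}
        = (P.map fun ω ↦ (x ω, fun i ↦ g i ω))
            {z : E × (Fin m → ℝ) | |(∑ i, a z.1 i * z.2 i) + b z.1| ≤ s} :=
          (Measure.map_apply_of_aemeasurable (hx.prodMk hgm) hA).symm
      _ = ∫⁻ z, (P.map fun ω i ↦ g i ω) {y | |(∑ i, a z i * y i) + b z| ≤ s} ∂(P.map x) := by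
          rw [hprod, Measure.prod_apply hA]
          rfl
      _ ≤ ∫⁻ z, ({z : E | ∑ i, a z i ^ 2 < κ}.indicator 1 z + C) ∂(P.map x) :=
          lintegral_mono hslice
      _ = P {ω | ∑ i, a (x ω) i ^ 2 < κ} + C := by
          rw [lintegral_add_right _ measurable_const, lintegral_indicator_one hD,
            Measure.map_apply_of_aemeasurable hx hD]
          simp
  have h0 : 0 ≤ 2 * s / √(2 * Real.pi * (κ * v)) := by positivity
  have h := ENNReal.toReal_mono (by simp [hC]) hmain
  rwa [ENNReal.toReal_add (measure_ne_top _ _) (by simp [hC]), hC, ENNReal.toReal_ofReal h0] at h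

end AntiConcentration

/-! ### Lower bound for the lag-one sum. -/

section LagOne

/-- Each lag-one product contains exactly one odd index. Grouping by it makes the quadratic sum
linear in the odd-indexed variables. -/
theorem sum_range_two_mul_lag (e : ℕ → ℝ) (m : ℕ) :
    ∑ i ∈ Finset.range (2 * m), e i * e (i + 1) =
      ∑ j ∈ Finset.range m, (e (2 * j) + e (2 * j + 2)) * e (2 * j + 1) := by
  induction m with
  | zero => simp
  | succ m ih =>
    rw [Finset.sum_range_succ, ← ih, show 2 * (m + 1) = 2 * m + 1 + 1 by ring,
      Finset.sum_range_succ, Finset.sum_range_succ]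
    ring

variable {Ω : Type*} [MeasurableSpace Ω] {P : Measure Ω} [IsProbabilityMeasure P]
  {ε : ℕ → Ω → ℝ} {v : ℝ≥0}

theorem measureReal_sum_sq_lt (hv : v ≠ 0) (hε : ∀ t, HasLaw (ε t) (gaussianReal 0 v) P)
    (hind : iIndepFun ε P) {m : ℕ} (hm : 0 < m) :
    P.real {ω | ∑ j : Fin m, (ε (2 * j) ω + ε (2 * j + 2) ω) ^ 2 < v * m} ≤ 96 / m := by
  have hv' : (0 : ℝ) < v := by positivity
  have hm' : (0 : ℝ) < m := by exact_mod_cast hm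
  -- The expectation is `2vm`. Expanding the square gives two diagonal sums and twice a cross sum;
  -- deviations below `vm/4` in each lose less than `vm` altogether.
  have hc : (0 : ℝ) < v * m / 4 := by positivity
  have hp0 : (fun j : Fin m ↦ 2 * (j : ℕ)).Injective := fun a b h ↦ by
    simp only at h; exact Fin.ext (by omega)
  have hp2 : (fun j : Fin m ↦ 2 * (j : ℕ) + 2).Injective := fun a b h ↦ by
    simp only at h; exact Fin.ext (by omega)
  have h1 := measureReal_le_abs_sum_whiteNoise hε hind hp0 hp0 hc
  have h2 := measureReal_le_abs_sum_whiteNoise hε hind hp2 hp2 hc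
  have h3 := measureReal_le_abs_sum_whiteNoise hε hind hp0 hp2 hc
  have hval : 2 * (v : ℝ) ^ 2 * m / (v * m / 4) ^ 2 = 32 / m := by field_simp; norm_num
  rw [hval] at h1 h2 h3
  refine (measureReal_mono ?_).trans ((measureReal_union_le _ _).trans
    ((add_le_add (measureReal_union_le _ _) le_rfl).trans
    ((add_le_add (add_le_add h1 h2) h3).trans (le_of_eq (by ring)))))
  intro ω hω
  by_contra hcon
  simp only [Set.mem_union, Set.mem_ofPred_eq, not_or, not_le, if_true, Finset.sum_const,
    Finset.card_univ, Fintype.card_fin, nsmul_eq_mul] at hcon hω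
  obtain ⟨⟨g1, g2⟩, g3⟩ := hcon
  have hne (j : Fin m) : ¬ (2 * (j : ℕ) = 2 * (j : ℕ) + 2) := by omega
  simp only [hne, if_false, Finset.sum_const_zero, sub_zero] at g3
  have hsum : ∑ j : Fin m, (ε (2 * j) ω + ε (2 * j + 2) ω) ^ 2 =
      (∑ j : Fin m, ε (2 * j) ω * ε (2 * j) ω) + (∑ j : Fin m, ε (2 * j + 2) ω * ε (2 * j + 2) ω) +
        2 * ∑ j : Fin m, ε (2 * j) ω * ε (2 * j + 2) ω := by
    rw [Finset.mul_sum, ← Finset.sum_add_distrib, ← Finset.sum_add_distrib]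
    exact Finset.sum_congr rfl fun j _ ↦ by ring
  rw [hsum] at hω
  rw [abs_lt] at g1 g2 g3
  linarith [g1.1, g2.1, g3.1]

/-- The lag-one sum of products of white noise is at least of order `√n` in probability. -/
theorem measureReal_abs_sum_lag_le (hv : v ≠ 0) (hε : ∀ t, HasLaw (ε t) (gaussianReal 0 v) P)
    (hind : iIndepFun ε P) {n : ℕ} (hn : 2 ≤ n) {κ : ℝ} (hκ : 0 ≤ κ) :
    P.real {ω | |∑ i : Fin n, ε i ω * ε (i + 1) ω| ≤ κ * √(n : ℝ)} ≤ 384 / n + 2 * κ / v := by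
  have hv' : (0 : ℝ) < v := by positivity
  obtain ⟨m, hm⟩ : ∃ m, m = n / 2 := ⟨_, rfl⟩
  have hm0 : 0 < m := by omega
  have hm' : (0 : ℝ) < m := by exact_mod_cast hm0
  have hn' : (0 : ℝ) < n := by exact_mod_cast (by omega : 0 < n)
  have hmn : (n : ℝ) ≤ 4 * m := by exact_mod_cast (by omega : n ≤ 4 * m)
  -- `G` holds the odd times integrated out, `T` the conditioned ones. For odd `n` the leftover
  -- product uses the times `2m` and `2m + 1`, both in `T`, and goes into the offset.
  let G : Finset ℕ := (Finset.range m).image fun j ↦ 2 * j + 1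
  let T : Finset ℕ := Finset.range (n + 2) \ G
  have hGmem (j : Fin m) : 2 * (j : ℕ) + 1 ∈ G :=
    Finset.mem_image.mpr ⟨j, Finset.mem_range.mpr j.2, rfl⟩
  have hTmem (t : ℕ) (ht : t < n + 2) (ht' : ∀ j < m, 2 * j + 1 ≠ t) : t ∈ T := by
    simp only [T, G, Finset.mem_sdiff, Finset.mem_range, Finset.mem_image, not_exists, not_and]
    exact ⟨ht, fun j hj ↦ ht' j hj⟩
  have hεm (t : ℕ) : AEMeasurable (ε t) P := (hε t).aemeasurable
  have hTG := hind.indepFun_finset₀ T G Finset.sdiff_disjoint hεm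
  let x : Ω → ℕ → ℝ := fun ω t ↦ if t ∈ T then ε t ω else 0
  let g : Fin m → Ω → ℝ := fun j ↦ ε (2 * j + 1)
  have hx : AEMeasurable x P := aemeasurable_pi_lambda _ fun t ↦ by
    by_cases ht : t ∈ T
    · simpa [x, ht] using hεm t
    · simp [x, ht]
  have hxg : IndepFun x (fun ω j ↦ g j ω) P := by
    have hφ : Measurable fun (y : T → ℝ) (t : ℕ) ↦ if h : t ∈ T then y ⟨t, h⟩ else 0 :=
      measurable_pi_lambda _ fun t ↦ by
        by_cases ht : t ∈ T
        · simpa [ht] using measurable_pi_apply _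
        · simp [ht]
    have hψ : Measurable fun (y : G → ℝ) (j : Fin m) ↦ y ⟨2 * j + 1, hGmem j⟩ := by fun_prop
    exact hTG.comp hφ hψ
  have hg : ∀ j, HasLaw (g j) (gaussianReal 0 v) P := fun j ↦ hε _
  have hgind : iIndepFun g P := hind.precomp (g := fun j : Fin m ↦ 2 * (j : ℕ) + 1) fun a b h ↦ by
    simp only at h; exact Fin.ext (by omega)
  have hmain := measureReal_abs_sum_le (s := κ * √(n : ℝ)) hv hx hg hgind hxg
    (a := fun z j ↦ z (2 * j) + z (2 * j + 2))
    (fun j ↦ by fun_prop) (b := fun z ↦ ∑ i ∈ Finset.Ico (2 * m) n, z i * z (i + 1))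
    (by fun_prop) (mul_pos hv' hm') (by positivity)
  have hxT {ω : Ω} {t : ℕ} (ht : t ∈ T) : x ω t = ε t ω := if_pos ht
  have heven (ω : Ω) (j : Fin m) : x ω (2 * j) = ε (2 * j) ω :=
    hxT (hTmem _ (by omega) fun i _ ↦ by omega)
  have heven' (ω : Ω) (j : Fin m) : x ω (2 * j + 2) = ε (2 * j + 2) ω :=
    hxT (hTmem _ (by omega) fun i _ ↦ by omega)
  have hsum (ω : Ω) : ∑ j, (x ω (2 * (j : Fin m)) + x ω (2 * j + 2)) * g j ω +
      ∑ i ∈ Finset.Ico (2 * m) n, x ω i * x ω (i + 1) = ∑ i : Fin n, ε i ω * ε (i + 1) ω := by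
    rw [Fin.sum_univ_eq_sum_range (fun i ↦ ε i ω * ε (i + 1) ω) n, Finset.range_eq_Ico,
      ← Finset.sum_Ico_consecutive _ (Nat.zero_le (2 * m)) (by omega), ← Finset.range_eq_Ico,
      sum_range_two_mul_lag (fun i ↦ ε i ω), ← Fin.sum_univ_eq_sum_range
        (fun j ↦ (ε (2 * j) ω + ε (2 * j + 2) ω) * ε (2 * j + 1) ω) m]
    congr 1
    · exact Finset.sum_congr rfl fun j _ ↦ by rw [heven, heven']
    · refine Finset.sum_congr rfl fun i hi ↦ ?_
      rw [Finset.mem_Ico] at hi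
      rw [hxT (hTmem _ (by omega) fun j _ ↦ by omega), hxT (hTmem _ (by omega) fun j _ ↦ by omega)]
  simp only [hsum] at hmain
  simp only [heven, heven'] at hmain
  refine hmain.trans (add_le_add ((measureReal_sum_sq_lt hv hε hind hm0).trans ?_) ?_)
  · rw [div_le_div_iff₀ hm' hn']
    linarith
  · rw [div_le_div_iff₀ (by positivity) hv']
    -- This uses `n ≤ 4m ≤ 2πm`.
    have hroot : √(n : ℝ) * v ≤ √(2 * Real.pi * (v * m * v)) := by
      refine Real.le_sqrt_of_sq_le ?_
      rw [mul_pow, Real.sq_sqrt hn'.le]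
      have h1 : (n : ℝ) * v ^ 2 ≤ 4 * m * v ^ 2 := by gcongr
      have h2 : 3 * (m * (v : ℝ) ^ 2) ≤ Real.pi * (m * (v : ℝ) ^ 2) := by
        have := Real.pi_gt_three.le
        gcongr
      nlinarith [mul_pos hm' (pow_pos hv' 2)]
    nlinarith

end LagOne

/-! ### The Frobenius norm as the norm of `vec`. -/

section Frobenius

open scoped Matrix.Norms.Frobenius in
theorem norm_evec_eq_frobenius {m n : Type*} [Fintype m] [Fintype n] (A : Matrix m n ℝ) :
    ‖evec A‖ = ‖A‖ := by
  rw [EuclideanSpace.norm_eq, Matrix.frobenius_norm_def, Real.sqrt_eq_rpow,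
    Fintype.sum_prod_type_right]
  simp [evec]

theorem norm_evec_mul_le {l m n : Type*} [Fintype l] [Fintype m] [Fintype n]
    (A : Matrix l m ℝ) (B : Matrix m n ℝ) : ‖evec (A * B)‖ ≤ ‖evec A‖ * ‖evec B‖ := by
  simp only [norm_evec_eq_frobenius]
  exact Matrix.frobenius_norm_mul A B

theorem norm_evec_smul {m n : Type*} [Fintype m] [Fintype n] (c : ℝ) (A : Matrix m n ℝ) :
    ‖evec (c • A)‖ = |c| * ‖evec A‖ := by
  rw [evec, Matrix.vec_smul, WithLp.toLp_smul, norm_smul, Real.norm_eq_abs, evec]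

theorem abs_apply_le_norm_evec {m n : Type*} [Fintype m] [Fintype n] (A : Matrix m n ℝ)
    (i : m) (j : n) : |A i j| ≤ ‖evec A‖ :=
  PiLp.norm_apply_le (evec A) (j, i)

theorem norm_evec_le_sum {m n : Type*} [Fintype m] [Fintype n] (A : Matrix m n ℝ) :
    ‖evec A‖ ≤ ∑ i, ∑ j, |A i j| := by
  rw [EuclideanSpace.norm_eq, Fintype.sum_prod_type_right]
  simp only [evec, Matrix.vec, Real.norm_eq_abs]
  refine Real.sqrt_le_iff.mpr ⟨by positivity, ?_⟩
  rw [← Fintype.sum_prod_type', ← Fintype.sum_prod_type']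
  exact Finset.sum_sq_le_sq_sum_of_nonneg fun _ _ ↦ abs_nonneg _

theorem continuous_norm_evec {m n : Type*} [Fintype m] [Fintype n] :
    Continuous fun A : Matrix m n ℝ ↦ ‖evec A‖ := by
  refine Continuous.norm ((PiLp.continuous_toLp 2 _).comp ?_)
  exact continuous_pi fun q ↦ continuous_id.matrix_elem q.2 q.1

end Frobenius

/-! ### The forecaster: population coefficients, deterministic bounds, Gram matrix. -/

section Forecaster

variable {Ω : Type*} [MeasurableSpace Ω] {P : Measure Ω} {ε : ℕ → Ω → ℝ} {v : ℝ≥0}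

/-- Within a row every history time precedes every future time, so all cross moments vanish,
whatever the inverse of the moment matrix is. -/
theorem popCoef_whiteNoise (hε : ∀ t, HasLaw (ε t) (gaussianReal 0 v) P) (hind : iIndepFun ε P)
    (L H T : ℕ) :
    popCoef P (fun ω ↦ history L H T fun t ↦ ε t ω) (fun ω ↦ future L H T fun t ↦ ε t ω) = 0 := by
  have h : moment P (fun ω ↦ history L H T fun t ↦ ε t ω)
      (fun ω ↦ future L H T fun t ↦ ε t ω) = 0 := by
    ext k j
    simp only [moment, history, future, Matrix.of_apply, Matrix.mul_apply, Matrix.transpose_apply,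
      Matrix.zero_apply]
    rw [integral_finsetSum _ fun i _ ↦ integrable_whiteNoise_mul hε _ _]
    refine mul_eq_zero_of_right _ (Finset.sum_eq_zero fun i _ ↦ ?_)
    rw [integral_whiteNoise_mul hε hind, if_neg]
    have := k.rev.2
    omega
  rw [popCoef, h, Matrix.mul_zero]

/-- The algebra behind the rate: bounds on the normalised Gram matrix and on the cross products
turn into bounds on the estimator. -/
theorem norm_estimator_bounds {N L H : ℕ} (hN : 0 < N) (X : Matrix (Fin N) (Fin L) ℝ)
    (Y : Matrix (Fin N) (Fin H) ℝ) {a a' κ K : ℝ} (ha' : 0 < a')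
    (hdet : ((N : ℝ)⁻¹ • (Xᵀ * X)).det ≠ 0)
    (hinv : ‖evec ((N : ℝ)⁻¹ • (Xᵀ * X))⁻¹‖ ≤ a) (hM : ‖evec ((N : ℝ)⁻¹ • (Xᵀ * X))‖ ≤ a')
    (hlow : κ * √(N : ℝ) ≤ ‖evec (Xᵀ * Y)‖) (hup : ‖evec (Xᵀ * Y)‖ ≤ K * √(N : ℝ)) :
    κ / a' / √(N : ℝ) ≤ ‖evec (estimator X Y)‖ ∧
      ‖evec (estimator X Y)‖ ≤ a * K / √(N : ℝ) := by
  have hN' : (0 : ℝ) < N := by exact_mod_cast hN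
  have hroot : √(N : ℝ) * √(N : ℝ) = N := Real.mul_self_sqrt hN'.le
  have hr : 0 < √(N : ℝ) := Real.sqrt_pos.mpr hN'
  have hU : IsUnit (Xᵀ * X).det := by
    rw [isUnit_iff_ne_zero]
    intro h0
    simp [h0] at hdet
  have hinv' : ((N : ℝ)⁻¹ • (Xᵀ * X))⁻¹ = (N : ℝ) • (Xᵀ * X)⁻¹ := by
    have := invertibleOfNonzero (inv_ne_zero hN'.ne')
    rw [Matrix.inv_smul _ _ hU]
    simp
  -- The lower bound multiplies back by the Gram matrix and uses its norm; the upper bound uses the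
  -- norm of its inverse.
  have h1 : Xᵀ * Y = (N : ℝ) • ((N : ℝ)⁻¹ • (Xᵀ * X) * estimator X Y) := by
    rw [estimator, Matrix.smul_mul, smul_smul, mul_inv_cancel₀ hN'.ne', one_smul,
      ← Matrix.mul_assoc, Matrix.mul_nonsing_inv _ hU, Matrix.one_mul]
  have h2 : estimator X Y = (N : ℝ)⁻¹ • (((N : ℝ)⁻¹ • (Xᵀ * X))⁻¹ * (Xᵀ * Y)) := by
    rw [hinv', Matrix.smul_mul, smul_smul, inv_mul_cancel₀ hN'.ne', one_smul, estimator]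
  constructor
  · have h3 : ‖evec (Xᵀ * Y)‖ ≤ N * (a' * ‖evec (estimator X Y)‖) := by
      conv_lhs => rw [h1]
      rw [norm_evec_smul, abs_of_pos hN']
      gcongr
      exact (norm_evec_mul_le _ _).trans (by gcongr)
    rw [div_div, div_le_iff₀ (by positivity)]
    refine le_of_mul_le_mul_right ?_ hr
    calc κ * √(N : ℝ) ≤ N * (a' * ‖evec (estimator X Y)‖) := hlow.trans h3
      _ = _ := by linear_combination (-(a' * ‖evec (estimator X Y)‖)) * hroot
  · rw [le_div_iff₀ hr]
    have h3 : ‖evec (estimator X Y)‖ ≤ (N : ℝ)⁻¹ * (a * (K * √(N : ℝ))) := by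
      conv_lhs => rw [h2]
      rw [norm_evec_smul, abs_of_pos (inv_pos.mpr hN')]
      gcongr
      exact (norm_evec_mul_le _ _).trans (mul_le_mul hinv hup (norm_nonneg _)
        ((norm_nonneg _).trans hinv))
    calc ‖evec (estimator X Y)‖ * √(N : ℝ)
        ≤ (N : ℝ)⁻¹ * (a * (K * √(N : ℝ))) * √(N : ℝ) := by gcongr
      _ = (N : ℝ)⁻¹ * (√(N : ℝ) * √(N : ℝ)) * (a * K) := by ring
      _ = a * K := by rw [hroot, inv_mul_cancel₀ hN'.ne', one_mul]

theorem tendsto_numWindows (L H : ℕ) : Tendsto (numWindows L H) atTop atTop := by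
  refine tendsto_atTop.mpr fun b ↦ ?_
  filter_upwards [eventually_ge_atTop (b + L + H)] with T hT
  simp only [numWindows]
  omega

variable [IsProbabilityMeasure P]

theorem tendsto_measureReal_gram_notMem (hε : ∀ t, HasLaw (ε t) (gaussianReal 0 v) P)
    (hind : iIndepFun ε P) (L H : ℕ) {U : Set (Matrix (Fin L) (Fin L) ℝ)}
    (hU : U ∈ 𝓝 ((v : ℝ) • (1 : Matrix (Fin L) (Fin L) ℝ))) :
    Tendsto (fun T ↦ P.real {ω | ((numWindows L H T : ℕ) : ℝ)⁻¹ •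
      ((history L H T fun t ↦ ε t ω)ᵀ * history L H T fun t ↦ ε t ω) ∉ U}) atTop (𝓝 0) := by
  refine tendsto_measureReal_notMem_nhds (Ω := fun _ ↦ Ω) (P := fun _ ↦ P)
    (A := fun _ ↦ (v : ℝ) • (1 : Matrix (Fin L) (Fin L) ℝ)) tendsto_const_nhds
    (fun k l c hc ↦ ?_) hU
  have hlim : Tendsto (fun T ↦ 2 * (v : ℝ) ^ 2 / c ^ 2 / ((numWindows L H T : ℕ) : ℝ)) atTop (𝓝 0) :=
    tendsto_const_nhds.div_atTop (tendsto_natCast_atTop_atTop.comp (tendsto_numWindows L H))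
  refine squeeze_zero' (Eventually.of_forall fun N ↦ measureReal_nonneg) ?_ hlim
  filter_upwards [(tendsto_numWindows L H).eventually_gt_atTop 0] with T hT
  have hn : (0 : ℝ) < (numWindows L H T : ℕ) := by exact_mod_cast hT
  have hinj (k : Fin L) : (fun i : Fin (numWindows L H T) ↦ (i : ℕ) + (k.rev : ℕ)).Injective :=
    fun a b h ↦ by simp only at h; exact Fin.ext (by omega)
  have h := measureReal_le_abs_sum_whiteNoise hε hind (hinj k) (hinj l) (mul_pos hc hn)
  refine le_trans (measureReal_mono fun ω hω ↦ ?_) (h.trans (le_of_eq ?_))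
  · simp only [Set.mem_ofPred_eq] at hω ⊢
    have hkl : (∑ i : Fin (numWindows L H T),
        if (i : ℕ) + (k.rev : ℕ) = i + (l.rev : ℕ) then (v : ℝ) else 0) =
        numWindows L H T * ((v : ℝ) • (1 : Matrix (Fin L) (Fin L) ℝ)) k l := by
      have hiff : L - ((k : ℕ) + 1) = L - ((l : ℕ) + 1) ↔ k = l := by rw [Fin.ext_iff]; omega
      simp [Matrix.one_apply, hiff]
    rw [hkl]
    simp only [Matrix.smul_apply _ (_ * _), Matrix.mul_apply, Matrix.transpose_apply, history,
      Matrix.of_apply, smul_eq_mul] at hω ⊢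
    calc c * (numWindows L H T : ℕ) ≤ _ := mul_le_mul_of_nonneg_right hω hn.le
      _ = _ := by
        nth_rewrite 2 [← abs_of_pos hn]
        rw [← abs_mul]
        congr 1
        field_simp
  · field_simp

end Forecaster

/-! ### The exact rate `1 / √T`. -/

section Rate

variable {Ω : Type*} [MeasurableSpace Ω] {P : Measure Ω} [IsProbabilityMeasure P]
  {ε : ℕ → Ω → ℝ} {v : ℝ≥0} {L H : ℕ}

/-- A union bound over the `L * H` entries, each a centred sum of variance at most `2 v² n`. -/
theorem measureReal_cross_ge (hε : ∀ t, HasLaw (ε t) (gaussianReal 0 v) P) (hind : iIndepFun ε P)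
    {T : ℕ} (hT : 0 < numWindows L H T) {K : ℝ} (hK : 0 < K) :
    P.real {ω | L * H * K * √((numWindows L H T : ℕ) : ℝ) <
      ‖evec ((history L H T fun t ↦ ε t ω)ᵀ * future L H T fun t ↦ ε t ω)‖} ≤
      L * H * (2 * (v : ℝ) ^ 2 / K ^ 2) := by
  have hn : (0 : ℝ) < (numWindows L H T : ℕ) := by exact_mod_cast hT
  have hr : 0 < √((numWindows L H T : ℕ) : ℝ) := Real.sqrt_pos.mpr hn
  let B : Fin L → Fin H → Set Ω := fun k j ↦ {ω | K * √((numWindows L H T : ℕ) : ℝ) ≤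
    |((history L H T fun t ↦ ε t ω)ᵀ * future L H T fun t ↦ ε t ω) k j|}
  have hB (k j) : P.real (B k j) ≤ 2 * (v : ℝ) ^ 2 / K ^ 2 := by
    have hp : (fun i : Fin (numWindows L H T) ↦ (i : ℕ) + (k.rev : ℕ)).Injective :=
      fun a b h ↦ by simp only at h; exact Fin.ext (by omega)
    have hq : (fun i : Fin (numWindows L H T) ↦ (i : ℕ) + L + (j : ℕ)).Injective :=
      fun a b h ↦ by simp only at h; exact Fin.ext (by omega)
    have hne (i : Fin (numWindows L H T)) : ¬ ((i : ℕ) + (k.rev : ℕ) = i + L + j) := by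
      have := k.rev.2
      omega
    have h := measureReal_le_abs_sum_whiteNoise hε hind hp hq (mul_pos hK hr)
    simp only [hne, if_false, Finset.sum_const_zero, sub_zero] at h
    refine h.trans (le_of_eq ?_)
    rw [mul_pow, Real.sq_sqrt hn.le]
    field_simp
  have hsub : {ω | L * H * K * √((numWindows L H T : ℕ) : ℝ) <
      ‖evec ((history L H T fun t ↦ ε t ω)ᵀ * future L H T fun t ↦ ε t ω)‖} ⊆ ⋃ k, ⋃ j, B k j := by
    intro ω hω
    by_contra hcon
    simp only [Set.mem_iUnion, B, Set.mem_ofPred_eq, not_exists, not_le] at hcon hω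
    refine absurd hω (not_lt.mpr ((norm_evec_le_sum _).trans
      ((Finset.sum_le_sum fun k _ ↦ Finset.sum_le_sum fun j _ ↦ (hcon k j).le).trans
      (le_of_eq ?_))))
    simp
    ring
  calc _ ≤ P.real (⋃ k, ⋃ j, B k j) := measureReal_mono hsub
    _ ≤ ∑ k, ∑ j, P.real (B k j) := (measureReal_iUnion_fintype_le _).trans
        (Finset.sum_le_sum fun k _ ↦ measureReal_iUnion_fintype_le _)
    _ ≤ ∑ _k : Fin L, ∑ _j : Fin H, 2 * (v : ℝ) ^ 2 / K ^ 2 :=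
        Finset.sum_le_sum fun k _ ↦ Finset.sum_le_sum fun j _ ↦ hB k j
    _ = _ := by simp; ring

/-- The norm dominates its `(0, 0)` entry, which is the lag-one sum of the series shifted by `L -
1`. -/
theorem measureReal_cross_le (hL : 0 < L) (hH : 0 < H) (hv : v ≠ 0)
    (hε : ∀ t, HasLaw (ε t) (gaussianReal 0 v) P) (hind : iIndepFun ε P)
    {T : ℕ} (hT : 2 ≤ numWindows L H T) {κ : ℝ} (hκ : 0 ≤ κ) :
    P.real {ω | ‖evec ((history L H T fun t ↦ ε t ω)ᵀ * future L H T fun t ↦ ε t ω)‖ ≤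
      κ * √((numWindows L H T : ℕ) : ℝ)} ≤ 384 / (numWindows L H T : ℕ) + 2 * κ / v := by
  have h := measureReal_abs_sum_lag_le (ε := fun t ↦ ε (t + (L - 1))) hv (fun t ↦ hε _)
    (hind.precomp (add_left_injective (L - 1))) hT hκ
  refine le_trans (measureReal_mono fun ω hω ↦ ?_) h
  simp only [Set.mem_ofPred_eq] at hω ⊢
  refine le_trans (le_of_eq ?_) ((abs_apply_le_norm_evec _ ⟨0, hL⟩ ⟨0, hH⟩).trans hω)
  simp only [Matrix.mul_apply, Matrix.transpose_apply, history, future, Matrix.of_apply]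
  congr 1
  refine Finset.sum_congr rfl fun i _ ↦ ?_
  have h1 : ((Fin.rev ⟨0, hL⟩ : Fin L) : ℕ) = L - 1 := by simp [Fin.val_rev]
  rw [h1, show (i : ℕ) + 1 + (L - 1) = i + L + 0 by omega]

/-- The least-squares forecaster fitted to white noise is of exact order `1 / √T`. -/
theorem exists_rate_estimator_whiteNoise (hL : 0 < L) (hH : 0 < H) (hv : v ≠ 0)
    (hε : ∀ t, HasLaw (ε t) (gaussianReal 0 v) P) (hind : iIndepFun ε P) {δ : ℝ} (hδ : 0 < δ) :
    ∃ c C : ℝ, 0 < c ∧ c < C ∧ ∀ᶠ T : ℕ in atTop,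
      1 - δ ≤ P.real {ω |
        c / √(T : ℝ) ≤ ‖evec (estimator (history L H T fun t ↦ ε t ω)
          (future L H T fun t ↦ ε t ω))‖ ∧
        ‖evec (estimator (history L H T fun t ↦ ε t ω)
          (future L H T fun t ↦ ε t ω))‖ ≤ C / √(T : ℝ)} := by
  have hv' : (0 : ℝ) < v := by positivity
  have hL' : (0 : ℝ) < L := by exact_mod_cast hL
  have hH' : (0 : ℝ) < H := by exact_mod_cast hH
  set S : Matrix (Fin L) (Fin L) ℝ := (v : ℝ) • (1 : Matrix (Fin L) (Fin L) ℝ) with hS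
  have hSdet : S.det ≠ 0 := by
    simp [hS, hv]
  obtain ⟨a, ha⟩ : ∃ a, a = ‖evec S⁻¹‖ + 1 := ⟨_, rfl⟩
  obtain ⟨a', ha'⟩ : ∃ a', a' = ‖evec S‖ + 1 := ⟨_, rfl⟩
  have ha0 : 0 < a := by rw [ha]; positivity
  have ha0' : 0 < a' := by rw [ha']; positivity
  have hU : {M : Matrix (Fin L) (Fin L) ℝ | M.det ≠ 0 ∧ ‖evec M⁻¹‖ ≤ a ∧ ‖evec M‖ ≤ a'} ∈ 𝓝 S := by
    have h1 : ∀ᶠ M in 𝓝 S, M.det ≠ 0 :=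
      (continuous_id.matrix_det.tendsto S).eventually_ne hSdet
    have h2 : ContinuousAt (Inv.inv : Matrix (Fin L) (Fin L) ℝ → _) S :=
      continuousAt_matrix_inv S (by rw [Ring.inverse_eq_inv']; exact continuousAt_inv₀ hSdet)
    have h3 : Tendsto (fun M : Matrix (Fin L) (Fin L) ℝ ↦ ‖evec M⁻¹‖) (𝓝 S) (𝓝 ‖evec S⁻¹‖) :=
      continuous_norm_evec.continuousAt.comp h2
    have h4 : Tendsto (fun M : Matrix (Fin L) (Fin L) ℝ ↦ ‖evec M‖) (𝓝 S) (𝓝 ‖evec S‖) :=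
      continuous_norm_evec.tendsto S
    filter_upwards [h1, h3.eventually_lt_const (u := a) (by linarith),
      h4.eventually_lt_const (u := a') (by linarith)] with M g1 g2 g3
    exact ⟨g1, g2.le, g3.le⟩
  -- The budget `δ` is split in four: the Gram matrix, the upper bound through `K`, and the two
  -- terms `384 / n` and `2 κ / v` of the lower bound.
  obtain ⟨κ, hκ⟩ : ∃ κ : ℝ, κ = v * δ / 8 := ⟨_, rfl⟩
  obtain ⟨K, hK⟩ : ∃ K : ℝ, K = √(8 * (L * H * v ^ 2) / δ) := ⟨_, rfl⟩
  have hκ0 : 0 < κ := by rw [hκ]; positivity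
  have hK0 : 0 < K := by rw [hK]; positivity
  have hKδ : L * H * (2 * (v : ℝ) ^ 2 / K ^ 2) = δ / 4 := by
    rw [hK, Real.sq_sqrt (by positivity)]
    field_simp
    norm_num
  have hκδ : 2 * κ / v = δ / 4 := by
    rw [hκ]
    field_simp
    norm_num
  have hc0 : 0 < κ / a' := by positivity
  -- The factor 2 pays for `√T ≤ 2√n`, with `n` the number of windows; the added `κ / a' + 1` only
  -- secures `c < C`.
  refine ⟨κ / a', 2 * (a * (L * H * K)) + κ / a' + 1, hc0,
    by have : 0 < 2 * (a * (L * H * K)) := by positivity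
       linarith, ?_⟩
  have hgram := (tendsto_measureReal_gram_notMem hε hind L H hU).eventually_lt_const
    (show (0 : ℝ) < δ / 4 by positivity)
  have hsmall : ∀ᶠ T in atTop, 384 / ((numWindows L H T : ℕ) : ℝ) < δ / 4 :=
    (tendsto_const_nhds.div_atTop
      (tendsto_natCast_atTop_atTop.comp (tendsto_numWindows L H))).eventually_lt_const (by positivity)
  filter_upwards [hgram, hsmall, (tendsto_numWindows L H).eventually_ge_atTop 2,
    eventually_ge_atTop (2 * (L + H))] with T h1 h2 h3 hTLH
  have hn0 : 0 < numWindows L H T := by omega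
  have hn : (0 : ℝ) < (numWindows L H T : ℕ) := by exact_mod_cast hn0
  have hnT : ((numWindows L H T : ℕ) : ℝ) ≤ T := by
    exact_mod_cast (by simp only [numWindows]; omega : numWindows L H T ≤ T)
  have hTn : (T : ℝ) ≤ 4 * (numWindows L H T : ℕ) := by
    exact_mod_cast (by simp only [numWindows]; omega : T ≤ 4 * numWindows L H T)
  have hT0 : (0 : ℝ) < T := hn.trans_le hnT
  have hrn : 0 < √((numWindows L H T : ℕ) : ℝ) := Real.sqrt_pos.mpr hn
  have hrT : 0 < √(T : ℝ) := Real.sqrt_pos.mpr hT0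
  have hr1 : √((numWindows L H T : ℕ) : ℝ) ≤ √(T : ℝ) := Real.sqrt_le_sqrt hnT
  have hr2 : √(T : ℝ) ≤ 2 * √((numWindows L H T : ℕ) : ℝ) := by
    refine Real.sqrt_le_iff.mpr ⟨by positivity, ?_⟩
    rw [mul_pow, Real.sq_sqrt hn.le]
    linarith
  have hup := measureReal_cross_ge (L := L) (H := H) hε hind hn0 hK0
  have hlow := measureReal_cross_le hL hH hv hε hind h3 hκ0.le
  set good : Set Ω := {ω | κ / a' / √(T : ℝ) ≤ ‖evec (estimator (history L H T fun t ↦ ε t ω)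
          (future L H T fun t ↦ ε t ω))‖ ∧
        ‖evec (estimator (history L H T fun t ↦ ε t ω)
          (future L H T fun t ↦ ε t ω))‖ ≤
            (2 * (a * (L * H * K)) + κ / a' + 1) / √(T : ℝ)} with hgood
  have hbad := measureReal_mono (μ := P) (s₁ := goodᶜ)
    (s₂ := ({ω | ((numWindows L H T : ℕ) : ℝ)⁻¹ •
      ((history L H T fun t ↦ ε t ω)ᵀ * history L H T fun t ↦ ε t ω) ∉
        {M : Matrix (Fin L) (Fin L) ℝ | M.det ≠ 0 ∧ ‖evec M⁻¹‖ ≤ a ∧ ‖evec M‖ ≤ a'}} ∪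
      {ω | L * H * K * √((numWindows L H T : ℕ) : ℝ) <
        ‖evec ((history L H T fun t ↦ ε t ω)ᵀ * future L H T fun t ↦ ε t ω)‖}) ∪
      {ω | ‖evec ((history L H T fun t ↦ ε t ω)ᵀ * future L H T fun t ↦ ε t ω)‖ ≤
        κ * √((numWindows L H T : ℕ) : ℝ)}) (by
    intro ω hω
    by_contra hcon
    simp only [Set.mem_union, Set.mem_ofPred_eq, not_or, not_not, not_lt, not_le] at hcon
    obtain ⟨⟨⟨g1, g2, g3⟩, g4⟩, g5⟩ := hcon
    obtain ⟨b1, b2⟩ := norm_estimator_bounds hn0 (history L H T fun t ↦ ε t ω)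
      (future L H T fun t ↦ ε t ω) ha0' g1 g2 g3 g5.le g4
    refine hω ⟨le_trans ?_ b1, b2.trans ?_⟩
    · gcongr
    · rw [div_le_div_iff₀ hrn hrT]
      have h5 : 0 < a * (L * H * K) := by positivity
      nlinarith [mul_le_mul_of_nonneg_left hr2 h5.le])
  have hbad' : P.real goodᶜ ≤ δ := by
    refine hbad.trans ((measureReal_union_le _ _).trans
      ((add_le_add (measureReal_union_le _ _) le_rfl).trans
      ((add_le_add (add_le_add h1.le hup) hlow).trans ?_)))
    linarith
  have htot : P.real (Set.univ : Set Ω) ≤ P.real good + P.real goodᶜ := by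
    rw [← Set.union_compl_self good]
    exact measureReal_union_le _ _
  rw [probReal_univ] at htot
  linarith

end Rate

end OLS

theorem mainTheorem3 (L H : ℕ) :
    -- asymptotic normality of the least-squares estimator, for a sequence of Gaussian designs
    (∀ (Ω : ℕ → Type*) [∀ N, MeasurableSpace (Ω N)]
        (P : ∀ N, Measure (Ω N)) [∀ N, IsProbabilityMeasure (P N)]
        (X : ∀ N, Ω N → Matrix (Fin N) (Fin L) ℝ) (Y : ∀ N, Ω N → Matrix (Fin N) (Fin H) ℝ)
        (CX : ∀ N, Matrix (Fin L × Fin N) (Fin L × Fin N) ℝ)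
        (CXY : ∀ N, Matrix (Fin L × Fin N) (Fin H × Fin N) ℝ)
        (CY : ∀ N, Matrix (Fin H × Fin N) (Fin H × Fin N) ℝ)
        (W : ℕ → Matrix (Fin L) (Fin H) ℝ)
        (S : Matrix (Fin L) (Fin L) ℝ) (R₀ : Matrix (Fin H) (Fin H) ℝ),
      -- `(vec X, vec Y)` is centred Gaussian with a covariance matrix given by blocks
      (∀ N, (OLS.jointCov (CX N) (CXY N) (CY N)).PosSemidef) →
      (∀ N, (CX N).PosDef) →
      (∀ N, HasLaw (fun ω => OLS.stackVec (X N ω) (Y N ω))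
        (multivariateGaussian 0 (OLS.jointCov (CX N) (CXY N) (CY N))) (P N)) →
      -- the linear model `Y = X W + E` with noise `E` independent of `X`
      (∀ N, IndepFun (fun ω => OLS.evec (X N ω))
        (fun ω => OLS.evec (Y N ω - X N ω * W N)) (P N)) →
      -- `Σ_res ≈ R₀ ⊗ I_N`, in operator norm
      Tendsto (fun N => ‖Matrix.toEuclideanCLM (𝕜 := ℝ)
        (OLS.resCov (CX N) (CXY N) (CY N) - R₀ ⊗ₖ (1 : Matrix (Fin N) (Fin N) ℝ))‖)
        atTop (𝓝 0) →
      -- `(1/N) 𝔼[XᵀX]` stabilises at a positive definite matrix, and the dependence between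
      -- the rows of `X` is weak on average
      Tendsto (fun N => OLS.moment (P N) (X N) (X N)) atTop (𝓝 S) →
      S.PosDef →
      Tendsto (fun N : ℕ => (1 / (N : ℝ) ^ 2) * ∑ p, ∑ q, (CX N p q) ^ 2) atTop (𝓝 0) →
      TendstoInDistribution
        (fun (N : ℕ) (ω : Ω N) => √(N : ℝ) •
          (OLS.evec (OLS.estimator (X N ω) (Y N ω)) -
            OLS.evec (OLS.popCoef (P N) (X N) (Y N))))
        atTop id P (multivariateGaussian 0 (R₀ ⊗ₖ S⁻¹))) ∧
    -- a linear forecaster fitted to a Gaussian white noise series of length `T`: the population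
    -- coefficients vanish and the fitted weights approach them at the exact rate `1 / √T`
    (0 < L → 0 < H →
      ∀ (Ω : Type*) [MeasurableSpace Ω] (P : Measure Ω) [IsProbabilityMeasure P]
        (ε : ℕ → Ω → ℝ) (v : ℝ≥0), v ≠ 0 →
      (∀ t, HasLaw (ε t) (gaussianReal 0 v) P) →
      iIndepFun ε P →
      (∀ T, OLS.popCoef P (fun ω => OLS.history L H T fun t => ε t ω)
        (fun ω => OLS.future L H T fun t => ε t ω) = 0) ∧
      ∀ δ : ℝ, 0 < δ → ∃ c C : ℝ, 0 < c ∧ c < C ∧ ∀ᶠ T : ℕ in atTop,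
        1 - δ ≤ P.real {ω |
          c / √(T : ℝ) ≤ ‖OLS.evec (OLS.estimator (OLS.history L H T fun t => ε t ω)
            (OLS.future L H T fun t => ε t ω))‖ ∧
          ‖OLS.evec (OLS.estimator (OLS.history L H T fun t => ε t ω)
            (OLS.future L H T fun t => ε t ω))‖ ≤ C / √(T : ℝ)}) := by
  refine ⟨?_, ?_⟩
  · intro Ω _ P _ X Y CX CXY CY W S R₀ hJ hCX hZ hind hres hmom hS hCX2
    exact OLS.tendstoInDistribution_estimator hJ hCX hZ hind hres hmom hS hCX2
  · intro hL hH Ω _ P _ ε v hv hε hind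
    exact ⟨OLS.popCoef_whiteNoise hε hind L H,
      fun δ hδ ↦ OLS.exists_rate_estimator_whiteNoise hL hH hv hε hind hδ⟩
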